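/- **Theorem.** Let $n\ge 1$ and $S=\mathbb C[a_1,\dots,a_n]$. Let $\hat\Lambda_S$ be the ring of formal power series in $y=(y_1,y_2,\dots)$ over $S$ that are symmetric in the $y_j$ (the graded completion of $S\otimes\Lambda$, with $\Lambda$ the ring of symmetric functions in $y$), and put $\Omega(u|y)=\prod_{j\ge1}\frac{1+uy_j}{1-uy_j}$. Let $P=\bigoplus_{k=1}^n\mathbb Z a_k$ be the weight lattice of $\mathfrak{sp}_{2n}(\mathbb C)$, with simple roots $\alpha_k=a_k-a_{k+1}$ ($1\le k<n$), $\alpha_n=2a_n$, highest root $\theta=2a_1$, and $\alpha_0=-\theta$. Let $\varepsilon_1,\dots,\varepsilon_n$ be the dual basis of $a_1,\dots,a_n$, so that the coroot lattice is $Q^\vee=\bigoplus_k\mathbb Z\varepsilon_k$ and $\theta^\vee=\varepsilon_1$; the fundamental coweights are $\varpi_k^\vee=\varepsilon_1+\dots+\varepsilon_k$ for $k<n$ and $\varpi_n^\vee=\frac12\sum_{k=1}^n\varepsilon_k$. Let $W=\langle s_1,\dots,s_n\rangle$ be the Weyl group, $W_{\mathrm{af}}=Q^\vee\rtimes W=\langle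 s_0,s_1,\dots,s_n\rangle$ with $s_0=t_{\theta^\vee}s_\theta$ the affine Weyl group (where $t_\mu$ is the translation by $\mu$), regarded as a subgroup of the extended affine Weyl group $P^\vee\rtimes W$ with $P^\vee=\bigoplus_k\mathbb Z\varpi_k^\vee$. Let $\ell$ be the length function of $W_{\mathrm{af}}$, and $W_{\mathrm{af}}^0$ the set of $w\in W_{\mathrm{af}}$ that have minimal length in their coset $wW$. Let $u_n\in W$ be the element with $u_n(a_k)=-a_{n+1-k}$ for all $k$, and $\pi_n=t_{\varpi_n^\vee}u_n$. Put $\kappa_i=t_{-\varpi_i^\vee}$ for $1\le i\le n-1$ and $\kappa_n=\pi_nt_{-\varpi_n^\vee}$; these are elements of $W_{\mathrm{af}}^0$. The group $W_{\mathrm{af}}$ acts on $\hat\Lambda_S$: $W$ acts on the coefficients in $S$ through its action on the $a_k$, and $t_{\varepsilon_k}$ acts as multiplication by $\Omega(a_k|y)$. For $0\le k\le n$ the operator $A_k=\alpha_k^{-1}(1-s_k)$ is well defined on $\hat\Lambda_S$. For $w\in W_{\mathrm{af}}$ put $A_w=A_{k_1}\cdots A_{k_l}$ for any reduced expression $w=s_{k_1}\cdots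 s_{k_l}$ (this does not depend on the expression), and for $w\in W_{\mathrm{af}}^0$ let $\hat P^{(n)}_w(y|a)=A_w(1)\in\hat\Lambda_S$. For $f(y|a)\in\hat\Lambda_S$, let $f(y|u_n(a))$ be obtained by replacing each $a_k$ by $-a_{n+1-k}$ in the coefficients. Let $1\le i\le n$ and let $v\in W_{\mathrm{af}}$ satisfy $v\kappa_i\in W_{\mathrm{af}}^0$ and $\ell(v\kappa_i)=\ell(v)+\ell(\kappa_i)$. * If $i\le n-1$, then $v\in W_{\mathrm{af}}^0$ and $\hat P^{(n)}_{v\kappa_i}(y|a)=\hat P^{(n)}_{\kappa_i}(y|a)\,\hat P^{(n)}_v(y|a)$. * If $i=n$, then $\bar v:=\pi_n^{-1}v\pi_n\in W_{\mathrm{af}}^0$ and $\hat P^{(n)}_{v\kappa_n}(y|a)=\hat P^{(n)}_{\kappa_n}(y|a)\,\hat P^{(n)}_{\bar v}(y|u_n(a))$. -/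

import Mathlib

noncomputable section

namespace AffC

/-! ## The symmetric function ring

`n` is the rank of `Sp_{2n}(ℂ)`. A Dynkin node `1 ≤ k ≤ n` is represented by `k - 1 : Fin n`, and
likewise the variable `a_k` by `a_{k-1}`; an affine node `0 ≤ k ≤ n` is `k : Fin (n + 1)`. -/

/-- `S = ℂ[a_1, …, a_n]`. -/
abbrev S (n : ℕ) : Type := MvPolynomial (Fin n) ℂ

/-- Formal power series in `y_1, y_2, …` that are invariant under permutations of the `y_j`: the
graded completion of `S ⊗ Λ`, where `Λ` is the ring of symmetric functions in `y`
over `ℂ`. -/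
def hatLam (n : ℕ) : Subalgebra (S n) (MvPowerSeries ℕ (S n)) where
  carrier := {f | ∀ σ : Equiv.Perm ℕ, MvPowerSeries.rename σ f = f}
  mul_mem' hf hg σ := by rw [map_mul, hf σ, hg σ]
  add_mem' hf hg σ := by rw [map_add, hf σ, hg σ]
  algebraMap_mem' r σ := AlgHom.commutes _ r

theorem mem_hatLam {n : ℕ} {f : MvPowerSeries ℕ (S n)} :
    f ∈ hatLam n ↔ ∀ σ : Equiv.Perm ℕ, MvPowerSeries.rename σ f = f := Iff.rfl

/-- The one-variable series `(1 + u t) / (1 - u t)`. -/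
def omegaOne {R : Type*} [CommRing R] (u : R) : PowerSeries R :=
  (1 + PowerSeries.C u * PowerSeries.X) * PowerSeries.mk fun k => u ^ k

theorem omegaOne_spec {R : Type*} [CommRing R] (u : R) :
    omegaOne u * (1 - PowerSeries.C u * PowerSeries.X) =
      1 + PowerSeries.C u * PowerSeries.X := by
  have h : (PowerSeries.mk fun k => u ^ k) * (1 - PowerSeries.C u * PowerSeries.X) = 1 := by
    ext k
    rw [mul_sub, mul_one, ← mul_assoc, map_sub, PowerSeries.coeff_mk]
    cases k with
    | zero => simp
    | succ k =>
      rw [PowerSeries.coeff_succ_mul_X, mul_comm, PowerSeries.coeff_C_mul,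
        PowerSeries.coeff_mk, PowerSeries.coeff_one]
      simp [pow_succ, mul_comm]
  rw [omegaOne, mul_assoc, h, mul_one]

theorem coeff_zero_omegaOne {R : Type*} [CommRing R] (u : R) :
    PowerSeries.coeff 0 (omegaOne u) = 1 := by
  simp [omegaOne]

/-- `Ω(u|y) = ∏_j (1 + u y_j) / (1 - u y_j)`: the factors have constant term `1`, so the
coefficient of `y^m` is the product over `j` of the coefficients of `y_j ^ (m j)`. -/
def omegaSeries {R : Type*} [CommRing R] (u : R) : MvPowerSeries ℕ R :=
  fun m => m.prod fun _ k => PowerSeries.coeff k (omegaOne u)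

theorem coeff_omegaSeries {R : Type*} [CommRing R] (u : R) (m : ℕ →₀ ℕ) :
    MvPowerSeries.coeff m (omegaSeries u) =
      m.prod fun _ k => PowerSeries.coeff k (omegaOne u) := rfl

theorem omegaSeries_mem {n : ℕ} (u : S n) : omegaSeries u ∈ hatLam n := by
  rw [mem_hatLam]
  intro σ
  ext1 m
  obtain ⟨m, rfl⟩ : ∃ m' : ℕ →₀ ℕ, m = m'.embDomain σ.toEmbedding := by
    refine ⟨m.embDomain σ.symm.toEmbedding, ?_⟩
    simp only [Finsupp.embDomain_eq_mapDomain, ← Finsupp.mapDomain_comp]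
    simp
  rw [coeff_omegaSeries, Finsupp.prod_embDomain]
  exact MvPowerSeries.coeff_embDomain_rename σ.toEmbedding (omegaSeries u) m

/-- `Ω(u|y)` as an element of the symmetric function ring. -/
def Om {n : ℕ} (u : S n) : hatLam n := ⟨omegaSeries u, omegaSeries_mem u⟩

/-- The action of a `ℂ`-algebra endomorphism of `S` on the coefficients of `f(y|a)`. -/
def mapCoeff {n : ℕ} (φ : S n →ₐ[ℂ] S n) (f : hatLam n) : hatLam n :=
  ⟨MvPowerSeries.map φ.toRingHom f.1, mem_hatLam.2 fun σ => by
    rw [MvPowerSeries.rename_map, mem_hatLam.1 f.2 σ]⟩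

/-! ## The root system of type `C_n` and the affine Weyl group -/

/-- The rational span of the coroots, with basis `ε_1, …, ε_n`. -/
abbrev V (n : ℕ) : Type := Fin n → ℚ

/-- `ε_i`. -/
def eps {n : ℕ} (i : Fin n) : V n := Pi.single i 1

/-- The weight `a_i`, as the `i`-th coordinate function. -/
def wt {n : ℕ} (i : Fin n) : Module.Dual ℚ (V n) := LinearMap.proj i

/-- The simple roots `α_i = a_i - a_{i+1}` for `i < n` and `α_n = 2 a_n`. -/
def simpleRoot {n : ℕ} (i : Fin n) : Module.Dual ℚ (V n) :=
  if h : (i : ℕ) + 1 < n then wt i - wt ⟨i + 1, h⟩ else (2 : ℚ) • wt i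

/-- The simple coroots `α_i^∨ = ε_i - ε_{i+1}` for `i < n` and `α_n^∨ = ε_n`. -/
def simpleCoroot {n : ℕ} (i : Fin n) : V n :=
  if h : (i : ℕ) + 1 < n then eps i - eps ⟨i + 1, h⟩ else eps i

theorem simpleRoot_simpleCoroot {n : ℕ} (i : Fin n) : simpleRoot i (simpleCoroot i) = 2 := by
  unfold simpleRoot simpleCoroot
  split_ifs with h
  · have h1 : (⟨i + 1, h⟩ : Fin n) ≠ i := by simp [Fin.ext_iff]
    simp [wt, eps, h1, h1.symm]
    norm_num
  · simp [wt, eps]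

/-- The highest root `θ = 2 a_1`. -/
def theta (n : ℕ) [NeZero n] : Module.Dual ℚ (V n) := (2 : ℚ) • wt 0

/-- Its coroot `θ^∨ = ε_1`. -/
def thetaCoroot (n : ℕ) [NeZero n] : V n := eps 0

theorem theta_thetaCoroot (n : ℕ) [NeZero n] : theta n (thetaCoroot n) = 2 := by
  simp [theta, thetaCoroot, wt, eps]

/-- The group of affine automorphisms of `V`. It contains the extended affine Weyl group
`P^∨ ⋊ W`: a coweight `μ` is the translation `t_μ`, and `W` acts linearly. -/
abbrev Aff (n : ℕ) : Type := V n ≃ᵃ[ℚ] V n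

/-- The translation `t_μ`. -/
def transl {n : ℕ} (μ : V n) : Aff n := AffineEquiv.constVAdd ℚ (V n) μ

/-- The simple reflections of the affine Weyl group: `s_i = s_{α_i}` for `1 ≤ i ≤ n`, and
`s_0 = t_{θ^∨} s_θ`. -/
def simpleRefl {n : ℕ} [NeZero n] : Fin (n + 1) → Aff n :=
  Fin.cases
    (transl (thetaCoroot n) * (Module.reflection (theta_thetaCoroot n)).toAffineEquiv)
    (fun i => (Module.reflection (simpleRoot_simpleCoroot i)).toAffineEquiv)

/-- The affine Weyl group `W_af = ⟨s_0, s_1, …, s_n⟩`. -/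
def Waf (n : ℕ) [NeZero n] : Subgroup (Aff n) := Subgroup.closure (Set.range simpleRefl)

/-- The finite Weyl group `W = ⟨s_1, …, s_n⟩`. -/
def Wfin (n : ℕ) [NeZero n] : Subgroup (Aff n) :=
  Subgroup.closure (Set.range fun i : Fin n => simpleRefl i.succ)

/-- The product of a word in the simple reflections. -/
def wordProd {n : ℕ} [NeZero n] (ω : List (Fin (n + 1))) : Aff n := (ω.map simpleRefl).prod

theorem exists_word {n : ℕ} [NeZero n] {w : Aff n} (hw : w ∈ Waf n) :
    ∃ ω : List (Fin (n + 1)), wordProd ω = w := by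
  have hinv : ∀ i : Fin (n + 1), (simpleRefl i : Aff n)⁻¹ = simpleRefl i := by
    intro i
    rw [inv_eq_iff_mul_eq_one]
    ext1 x
    refine Fin.cases ?_ (fun i => ?_) i
    · have h2 := theta_thetaCoroot n
      simp only [simpleRefl, Fin.cases_zero, transl, AffineEquiv.mul_def, AffineEquiv.trans_apply,
        AffineEquiv.one_def, AffineEquiv.refl_apply, AffineEquiv.constVAdd_apply,
        LinearEquiv.coe_toAffineEquiv, Module.reflection_apply, vadd_eq_add, map_add, map_sub,
        map_smul, h2]
      module
    · have h2 := simpleRoot_simpleCoroot i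
      simp only [simpleRefl, Fin.cases_succ, AffineEquiv.mul_def, AffineEquiv.trans_apply,
        AffineEquiv.one_def, AffineEquiv.refl_apply,
        LinearEquiv.coe_toAffineEquiv, Module.reflection_apply, map_sub,
        map_smul, h2]
      module
  induction hw using Subgroup.closure_induction with
  | mem x hx =>
    obtain ⟨i, rfl⟩ := hx
    exact ⟨[i], by simp [wordProd]⟩
  | one => exact ⟨[], rfl⟩
  | mul x y _ _ hx hy =>
    obtain ⟨a, rfl⟩ := hx
    obtain ⟨b, rfl⟩ := hy
    exact ⟨a ++ b, by simp [wordProd]⟩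
  | inv x hx0 hx =>
    clear hx0
    obtain ⟨a, rfl⟩ := hx
    refine ⟨a.reverse, ?_⟩
    induction a with
    | nil => simp [wordProd]
    | cons i a ih =>
      simp only [wordProd, List.reverse_cons, List.map_append, List.prod_append, List.map_cons,
        List.prod_cons, List.map_nil, List.prod_nil, mul_one, mul_inv_rev, hinv] at ih ⊢
      rw [ih]

/-- The length of an element of `W_af`. -/
def len {n : ℕ} [NeZero n] (w : Aff n) : ℕ :=
  sInf {k | ∃ ω : List (Fin (n + 1)), wordProd ω = w ∧ ω.length = k}

theorem exists_reduced {n : ℕ} [NeZero n] {w : Aff n} (hw : w ∈ Waf n) :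
    ∃ ω : List (Fin (n + 1)), wordProd ω = w ∧ ω.length = len w := by
  obtain ⟨ω, h⟩ := exists_word hw
  exact Nat.sInf_mem (s := {k | ∃ ω : List (Fin (n + 1)), wordProd ω = w ∧ ω.length = k})
    ⟨_, ω, h, rfl⟩

/-- `W_af^0`: the elements of `W_af` of minimal length in their coset `w W`. -/
def Waf0 (n : ℕ) [NeZero n] : Set (Aff n) :=
  {w | w ∈ Waf n ∧ ∀ u ∈ Wfin n, len w ≤ len (w * u)}

/-- The fundamental coweights `ϖ_i^∨ = ε_1 + ⋯ + ε_i` for `i < n` and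
`ϖ_n^∨ = (ε_1 + ⋯ + ε_n) / 2`. -/
def fundCoweight {n : ℕ} (i : Fin n) : V n :=
  if (i : ℕ) + 1 < n then ∑ k ∈ Finset.Iic i, eps k else (1 / 2 : ℚ) • ∑ k, eps k

/-- The element `u_n` of `W`, acting by `ε_i ↦ -ε_{n+1-i}` (hence also `a_i ↦ -a_{n+1-i}`). -/
def uN (n : ℕ) : V n ≃ₗ[ℚ] V n :=
  (LinearEquiv.funCongrLeft ℚ ℚ Fin.revPerm).trans (LinearEquiv.neg ℚ)

/-- The index `n` of the last node. -/
def lastNode (n : ℕ) [NeZero n] : Fin n := Fin.rev 0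

/-- The length-zero element `π_n = t_{ϖ_n^∨} u_n` of the extended affine Weyl group. -/
def piN (n : ℕ) [NeZero n] : Aff n :=
  transl (fundCoweight (lastNode n)) * (uN n).toAffineEquiv

/-- `κ_i = π_{i^s} t_{-ϖ_i^∨}`, where `i^s ∈ {0, n}` is the special node with
`ϖ_i^∨ ≡ ϖ_{i^s}^∨` modulo the coroot lattice: `i^s = 0` and `π_0 = 1` for `i < n`, and `i^s = n`
for `i = n`. -/
def kappa {n : ℕ} [NeZero n] (i : Fin n) : Aff n :=
  (if (i : ℕ) + 1 < n then 1 else piN n) * transl (-fundCoweight i)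

/-! ## The level zero action and the dual affine Schur `P`-functions -/

/-- A linear form on `V`, as a linear polynomial in `a_1, …, a_n`. -/
def formToS {n : ℕ} (f : Module.Dual ℚ (V n)) : S n :=
  ∑ j, MvPolynomial.C ((f (eps j) : ℚ) : ℂ) * MvPolynomial.X j

/-- The action on `S` of a linear automorphism `g` of `V`, by `a_i ↦ a_i ∘ g⁻¹`. -/
def linAct {n : ℕ} (g : V n ≃ₗ[ℚ] V n) : S n →ₐ[ℂ] S n :=
  MvPolynomial.aeval fun i => formToS (wt i ∘ₗ (g.symm : V n →ₗ[ℚ] V n))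

/-- `α_i ∈ S` for an affine node `i`, with `α_0 = -θ`. -/
def rootS {n : ℕ} [NeZero n] : Fin (n + 1) → S n :=
  Fin.cases (formToS (-theta n)) (fun i => formToS (simpleRoot i))

/-- The translation `t_{ε_i}` acts on symmetric functions as multiplication by `Ω(a_i|y)`. -/
def epsAct {n : ℕ} (i : Fin n) (f : hatLam n) : hatLam n := Om (MvPolynomial.X i) * f

/-- The action of the simple reflections on symmetric functions: `s_i` with `1 ≤ i ≤ n` acts on
the coefficients, and `s_0 = t_{θ^∨} s_θ` with `θ^∨ = ε_1`. -/
def reflAct {n : ℕ} [NeZero n] : Fin (n + 1) → hatLam n → hatLam n :=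
  Fin.cases
    (fun f => epsAct 0 (mapCoeff (linAct (Module.reflection (theta_thetaCoroot n))) f))
    (fun i f => mapCoeff (linAct (Module.reflection (simpleRoot_simpleCoroot i))) f)

theorem formToS_sub_smul {n : ℕ} (f g : Module.Dual ℚ (V n)) (c : ℚ) :
    formToS (f - c • g) = formToS f - MvPolynomial.C (c : ℂ) * formToS g := by
  simp only [formToS, Finset.mul_sum, ← Finset.sum_sub_distrib]
  refine Finset.sum_congr rfl fun j _ => ?_
  simp only [LinearMap.sub_apply, LinearMap.smul_apply, smul_eq_mul, Rat.cast_sub, Rat.cast_mul,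
    map_sub, map_mul]
  ring

theorem formToS_wt {n : ℕ} (i : Fin n) : formToS (wt i) = MvPolynomial.X i := by
  rw [formToS, Finset.sum_eq_single i]
  · simp [wt, eps]
  · intro j _ hj
    simp [wt, eps, hj.symm]
  · simp

theorem formToS_ne_zero {n : ℕ} {f : Module.Dual ℚ (V n)} (hf : f ≠ 0) : formToS f ≠ 0 := by
  intro h
  apply hf
  refine LinearMap.pi_ext' fun j => ?_
  ext1
  have h1 := congrArg (MvPolynomial.coeff (Finsupp.single j 1)) h
  simp only [formToS, MvPolynomial.coeff_sum, MvPolynomial.coeff_C_mul,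
    MvPolynomial.coeff_zero] at h1
  rw [Finset.sum_eq_single j] at h1
  · simpa [eps] using h1
  · intro k _ hk
    rw [MvPolynomial.coeff_X, if_neg, mul_zero]
    simpa [Finsupp.single_left_inj] using hk
  · simp

theorem formToS_dvd_sub {n : ℕ} {f : Module.Dual ℚ (V n)} {x : V n} (h : f x = 2) (p : S n) :
    formToS f ∣ p - linAct (Module.reflection h) p := by
  rw [← Ideal.mem_span_singleton, ← Ideal.Quotient.eq]
  have key : (Ideal.Quotient.mkₐ ℂ (Ideal.span {formToS f})) =
      (Ideal.Quotient.mkₐ ℂ (Ideal.span {formToS f})).comp (linAct (Module.reflection h)) := by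
    ext i
    simp only [AlgHom.comp_apply, linAct, MvPolynomial.aeval_X, Ideal.Quotient.mkₐ_eq_mk]
    rw [Ideal.Quotient.eq, Ideal.mem_span_singleton]
    have : (wt i ∘ₗ ((Module.reflection h).symm : V n →ₗ[ℚ] V n)) = wt i - (wt i x) • f := by
      ext1 j
      ext1
      simp [Module.reflection_symm, Module.reflection_apply, mul_comm]
    rw [this, formToS_sub_smul, formToS_wt, sub_sub_cancel]
    exact Dvd.intro_left _ rfl
  exact DFunLike.congr_fun key p

theorem dvd_coeff_omegaSeries {R : Type*} [CommRing R] (u : R) {m : ℕ →₀ ℕ} (hm : m ≠ 0) :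
    u ∣ MvPowerSeries.coeff m (omegaSeries u) := by
  obtain ⟨j, hj⟩ := Finsupp.support_nonempty_iff.2 hm
  rw [coeff_omegaSeries]
  refine dvd_trans ?_ (Finset.dvd_prod_of_mem _ hj)
  obtain ⟨k, hk⟩ := Nat.exists_eq_succ_of_ne_zero (Finsupp.mem_support_iff.1 hj)
  simp only [hk, omegaOne, add_mul, one_mul, mul_assoc, map_add, PowerSeries.coeff_C_mul,
    PowerSeries.coeff_mk]
  exact dvd_add (dvd_pow_self u (Nat.succ_ne_zero k)) (dvd_mul_right u _)

theorem rootS_ne_zero {n : ℕ} [NeZero n] (i : Fin (n + 1)) : (rootS i : S n) ≠ 0 := by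
  refine Fin.cases (formToS_ne_zero ?_) (fun i => formToS_ne_zero ?_) i
  · intro h
    have := theta_thetaCoroot n
    rw [neg_eq_zero.1 h] at this
    simp at this
  · intro h
    have := simpleRoot_simpleCoroot i
    rw [h] at this
    simp at this

theorem rootS_zero {n : ℕ} [NeZero n] : (rootS 0 : S n) = -formToS (theta n) := by
  simp [rootS, formToS]

theorem rootS_dvd_coeff {n : ℕ} [NeZero n] (i : Fin (n + 1)) (f : hatLam n) (m : ℕ →₀ ℕ) :
    rootS i ∣ MvPowerSeries.coeff m (f - reflAct i f : hatLam n).1 := by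
  refine Fin.cases ?_ (fun i => ?_) i
  · rw [rootS_zero, neg_dvd]
    set I := Ideal.span {formToS (theta n)} with hI
    have h1 : MvPowerSeries.map (Ideal.Quotient.mk I)
        (mapCoeff (linAct (Module.reflection (theta_thetaCoroot n))) f).1 =
        MvPowerSeries.map (Ideal.Quotient.mk I) f.1 := by
      ext m
      rw [MvPowerSeries.coeff_map, MvPowerSeries.coeff_map, eq_comm, Ideal.Quotient.eq, hI,
        Ideal.mem_span_singleton]
      exact formToS_dvd_sub (theta_thetaCoroot n) _
    have hX : formToS (theta n) ∣ (MvPolynomial.X 0 : S n) := by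
      refine ⟨MvPolynomial.C (1 / 2), ?_⟩
      have := formToS_sub_smul (0 : Module.Dual ℚ (V n)) (wt 0) (-2)
      rw [formToS_wt] at this
      have h0 : (0 : Module.Dual ℚ (V n)) - (-2 : ℚ) • wt 0 = theta n := by
        rw [theta, neg_smul, zero_sub, neg_neg]
      rw [h0] at this
      rw [this, show formToS (0 : Module.Dual ℚ (V n)) = 0 by simp [formToS], zero_sub,
        mul_comm, ← neg_mul, ← map_neg, ← mul_assoc, ← map_mul]
      norm_num
    have h2 : MvPowerSeries.map (Ideal.Quotient.mk I)
        (Om (MvPolynomial.X 0 : S n)).1 = 1 := by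
      ext m
      rw [MvPowerSeries.coeff_map, MvPowerSeries.coeff_one]
      split_ifs with hm
      · subst hm
        simp [Om, coeff_omegaSeries]
      · rw [Ideal.Quotient.eq_zero_iff_mem, hI, Ideal.mem_span_singleton]
        exact hX.trans (dvd_coeff_omegaSeries _ hm)
    rw [← Ideal.mem_span_singleton, ← hI, ← Ideal.Quotient.eq_zero_iff_mem,
      ← MvPowerSeries.coeff_map]
    have h3 : (f - reflAct 0 f : hatLam n).1 = f.1 - (Om (MvPolynomial.X 0 : S n)).1 *
        (mapCoeff (linAct (Module.reflection (theta_thetaCoroot n))) f).1 := rfl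
    rw [h3, map_sub, map_mul, h1, h2, one_mul, sub_self, map_zero]
  · exact formToS_dvd_sub (simpleRoot_simpleCoroot i) (MvPowerSeries.coeff m f.1)

/-- Exact division by `α_i` is possible, in a unique way. -/
theorem existsUnique_divDiff {n : ℕ} [NeZero n] (i : Fin (n + 1)) (f : hatLam n) :
    ∃! g : hatLam n, rootS i • g = f - reflAct i f := by
  have hinj : ∀ g g' : MvPowerSeries ℕ (S n), rootS i • g = rootS i • g' → g = g' := by
    intro g g' h
    ext1 m
    have := congrArg (MvPowerSeries.coeff m) h
    rw [MvPowerSeries.coeff_smul, MvPowerSeries.coeff_smul] at this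
    exact mul_left_cancel₀ (rootS_ne_zero i) this
  choose c hc using rootS_dvd_coeff i f
  let g : MvPowerSeries ℕ (S n) := c
  have hg : rootS i • g = (f - reflAct i f : hatLam n).1 := by
    ext1 m
    rw [MvPowerSeries.coeff_smul, hc m]
    rfl
  have hmem : g ∈ hatLam n := mem_hatLam.2 fun σ => hinj _ _ (by
    rw [← map_smul, hg, mem_hatLam.1 (f - reflAct i f).2 σ])
  refine ⟨⟨g, hmem⟩, Subtype.ext hg, fun g' hg' => Subtype.ext (hinj _ _ ?_)⟩
  rw [hg]
  exact congrArg Subtype.val hg'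

/-- The operator `A_i = α_i⁻¹ (1 - s_i)` on symmetric functions, for `0 ≤ i ≤ n`. -/
def divDiff {n : ℕ} [NeZero n] (i : Fin (n + 1)) (f : hatLam n) : hatLam n :=
  (existsUnique_divDiff i f).choose

open Classical in
/-- A reduced word of `w ∈ W_af`. -/
def redWord {n : ℕ} [NeZero n] (w : Aff n) : List (Fin (n + 1)) :=
  if h : w ∈ Waf n then (exists_reduced h).choose else []

/-- The operator `A_w = A_{i_1} ⋯ A_{i_l}`, where `w = s_{i_1} ⋯ s_{i_l}` is a reduced expression
of `w ∈ W_af`. (By the braid relations it does not depend on the reduced expression.) -/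
def divDiffW {n : ℕ} [NeZero n] (w : Aff n) (f : hatLam n) : hatLam n :=
  (redWord w).foldr divDiff f

/-- The dual affine Schur `P`-function `A_w(1)` of `w ∈ W_af^0`. -/
def Phat {n : ℕ} [NeZero n] (w : Aff n) : hatLam n := divDiffW w 1

/-- The substitution `f(y|a) ↦ f(y|u_n(a))`. -/
def substUN {n : ℕ} (f : hatLam n) : hatLam n := mapCoeff (linAct (uN n)) f

end AffC

end

noncomputable section

namespace AffC

/-! ## Affine roots -/

/-! Write F for the `Phat` of κ_i. Lengths add, so A_{vκ_i} = A_v A_{κ_i}, and the problem is to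
compute A_v(F). The key fact is that F is annihilated by A_j, equivalently fixed by s_j, for every
affine node j but one (`DiagramAut.divDiff_Phat_eq_zero`). Write κ_i = π t_{-ϖ_i^∨}, where π is 1 or
π_n and permutes the affine nodes by s_j π = π s_{j'}, and let j' ≠ 0. If j' = i, then s_j is a left
descent of κ_i, so F lies in the image of A_j, and A_j² = 0. If j' ≠ i, then s_{j'} commutes with
the translation, so s_j κ_i = κ_i s_{j'} with lengths adding on both sides, and A_j F = A_{κ_i}
A_{j'}(1) = 0.

For i < n this makes F invariant under W. Since s_0 is s_θ on coefficients followed by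
multiplication by Ω(a_1), multiplication by F commutes with every s_j and every A_j, whence A_v(F) =
F · A_v(1). For i = n, F is fixed by s_0, …, s_{n-1}. Carrying F = Ω(a_1) s_θ(F) along the
permutations of the a_k gives F = Ω(a_n) s_n(F). Therefore g ↦ F · u_n(g) intertwines s_{n-j} with
s_j, hence A_{n-j} with A_j (`DiagramAut.divDiff_mul_act`). Conjugation by π_n relabels words by j ↦
n - j, so iterating along a reduced word of v gives the formula.

Independence of A_w from the reduced word is Matsumoto's theorem (`BraidRels.foldr_eq`) applied to
`braidRels_divDiff`. Lengths are handled by counting the affine roots that change sign between a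
base point and its image (`len_eq_numInv`). The same count shows that the conjugate v̄ of v by π is
minimal in its coset: for u in W the element u⁻¹ t_μ u has at most as many inversions as t_μ
(`ncard_sep_transl_le`), so ℓ(v̄) + ℓ(κ_i) = ℓ(vκ_i) ≤ ℓ(vκ_i u) ≤ ℓ(v̄u) + ℓ(κ_i). -/

/-- The linear parts of the affine simple roots. -/
def lroot {n : ℕ} [NeZero n] : Fin (n + 1) → Module.Dual ℚ (V n) :=
  Fin.cases (-theta n) simpleRoot

/-- The coroots of the affine simple roots. -/
def scoroot {n : ℕ} [NeZero n] : Fin (n + 1) → V n :=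
  Fin.cases (-eps 0) simpleCoroot

/-- The affine simple roots, as functions on `V`; the one at the node `0` is `1 - θ`. -/
def sroot {n : ℕ} [NeZero n] (i : Fin (n + 1)) (x : V n) : ℚ :=
  lroot i x + if i = 0 then 1 else 0

theorem eps_apply {n : ℕ} (i p : Fin n) : (eps i : V n) p = if p = i then 1 else 0 := by
  simp [eps, Pi.single_apply]

section
variable {n : ℕ} [NeZero n]

theorem lroot_zero : (lroot 0 : Module.Dual ℚ (V n)) = -theta n := rfl

theorem lroot_succ (i : Fin n) : lroot i.succ = simpleRoot i := rfl

theorem scoroot_zero : (scoroot 0 : V n) = -eps 0 := rfl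

theorem scoroot_succ (i : Fin n) : scoroot i.succ = simpleCoroot i := rfl

theorem sroot_zero (x : V n) : sroot 0 x = 1 - 2 * x 0 := by
  simp [sroot, lroot, theta, wt]; ring

theorem sroot_mid {i : Fin n} (h : (i : ℕ) + 1 < n) (x : V n) :
    sroot i.succ x = x i - x ⟨i + 1, h⟩ := by
  simp [sroot, lroot, simpleRoot, h, wt]

theorem sroot_last {i : Fin n} (h : ¬ (i : ℕ) + 1 < n) (x : V n) :
    sroot i.succ x = 2 * x i := by
  simp [sroot, lroot, simpleRoot, h, wt]

theorem lroot_scoroot_self (i : Fin (n + 1)) : lroot i (scoroot i) = (2 : ℚ) := by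
  refine Fin.cases ?_ (fun i => ?_) i
  · have := theta_thetaCoroot n
    simpa [lroot, scoroot, thetaCoroot] using this
  · exact simpleRoot_simpleCoroot i

theorem sroot_add (i : Fin (n + 1)) (x v : V n) : sroot i (x + v) = sroot i x + lroot i v := by
  simp only [sroot, map_add]; ring

/-- The constant 1 in the affine root at the node 0 absorbs the translation by θ^∨, so that s_0
needs no separate treatment afterwards. -/
theorem simpleRefl_apply (i : Fin (n + 1)) (x : V n) :
    simpleRefl i x = x - sroot i x • scoroot i := by
  refine Fin.cases ?_ (fun i => ?_) i
  · simp only [simpleRefl, Fin.cases_zero, transl, AffineEquiv.mul_def, AffineEquiv.trans_apply,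
      AffineEquiv.constVAdd_apply, LinearEquiv.coe_toAffineEquiv, Module.reflection_apply,
      vadd_eq_add, sroot, lroot, scoroot, thetaCoroot, if_true, LinearMap.neg_apply]
    module
  · simp only [simpleRefl, Fin.cases_succ, LinearEquiv.coe_toAffineEquiv, Module.reflection_apply,
      sroot, lroot, scoroot, Fin.succ_ne_zero, if_false, add_zero]

theorem sroot_simpleRefl (i j : Fin (n + 1)) (x : V n) :
    sroot j (simpleRefl i x) = sroot j x - lroot j (scoroot i) * sroot i x := by
  rw [simpleRefl_apply, sub_eq_add_neg, sroot_add, map_neg, map_smul, smul_eq_mul]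
  ring

theorem sroot_simpleRefl_self (i : Fin (n + 1)) (x : V n) :
    sroot i (simpleRefl i x) = - sroot i x := by
  rw [sroot_simpleRefl, lroot_scoroot_self]; ring

theorem simpleRefl_mul_self (i : Fin (n + 1)) : (simpleRefl i * simpleRefl i : Aff n) = 1 := by
  ext1 x
  change simpleRefl i (simpleRefl i x) = x
  rw [simpleRefl_apply i (simpleRefl i x), sroot_simpleRefl_self, simpleRefl_apply]
  module

theorem simpleRefl_simpleRefl (i : Fin (n + 1)) (x : V n) :
    simpleRefl i (simpleRefl i x) = x :=
  DFunLike.congr_fun (simpleRefl_mul_self i) x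

theorem simpleRefl_mem (i : Fin (n + 1)) : simpleRefl i ∈ Waf n :=
  Subgroup.subset_closure ⟨i, rfl⟩

theorem wordProd_mem (ω : List (Fin (n + 1))) : wordProd ω ∈ Waf n :=
  Subgroup.list_prod_mem _ fun x hx => by
    obtain ⟨i, _, rfl⟩ := List.mem_map.1 hx
    exact simpleRefl_mem i

theorem wordProd_cons (i : Fin (n + 1)) (ω : List (Fin (n + 1))) :
    wordProd (i :: ω) = simpleRefl i * wordProd ω := by simp [wordProd]

theorem wordProd_append (ω ω' : List (Fin (n + 1))) :
    wordProd (ω ++ ω') = wordProd ω * wordProd ω' := by simp [wordProd]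

/-! ### The Cartan matrix -/

theorem cartan_far {i j : Fin (n + 1)} (h : (i : ℕ) + 1 < j) :
    lroot j (scoroot i) = (0 : ℚ) ∧ lroot i (scoroot j) = (0 : ℚ) := by
  obtain ⟨j, rfl⟩ := Fin.exists_succ_eq.2 (show j ≠ 0 by rintro rfl; simp at h)
  refine Fin.cases (fun h => ?_) (fun i h => ?_) i h
  · have h0 : (j : ℕ) ≠ 0 := by
      rw [Fin.val_succ, Fin.val_zero] at h; omega
    simp only [lroot, scoroot, Fin.cases_zero, Fin.cases_succ, simpleRoot, simpleCoroot, theta]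
    split_ifs <;> simp [wt, eps_apply, Fin.ext_iff, h0, h0.symm]
  · simp only [Fin.val_succ] at h
    have hij : i ≠ j := by rintro rfl; omega
    have h1 : ∀ h', i ≠ ⟨j + 1, h'⟩ := by intro h'; simp [Fin.ext_iff]; omega
    have h2 : ∀ h', j ≠ ⟨i + 1, h'⟩ := by intro h'; simp [Fin.ext_iff]; omega
    simp only [lroot, scoroot, Fin.cases_succ, simpleRoot, simpleCoroot]
    split_ifs <;> simp [wt, eps_apply, hij, h1, h2, hij.symm, fun h' => (h1 h').symm,
      fun h' => (h2 h').symm, Fin.ext_iff] <;> omega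

theorem cartan_zero_one (h : 1 < n) :
    lroot (0 : Fin n).succ (scoroot 0) = (-1 : ℚ) ∧
      lroot 0 (scoroot (0 : Fin n).succ) = (-2 : ℚ) := by
  rw [lroot_zero, lroot_succ, scoroot_zero, scoroot_succ]
  simp [simpleRoot, simpleCoroot, theta, h, wt, eps_apply, Fin.ext_iff]

theorem cartan_mid {i : Fin n} (h : (i : ℕ) + 1 < n) (h' : (i : ℕ) + 1 + 1 < n) :
    lroot (⟨i + 1, h⟩ : Fin n).succ (scoroot i.succ) = (-1 : ℚ) ∧
      lroot i.succ (scoroot (⟨i + 1, h⟩ : Fin n).succ) = (-1 : ℚ) := by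
  rw [lroot_succ, lroot_succ, scoroot_succ, scoroot_succ]
  simp [simpleRoot, simpleCoroot, h, h', wt, eps_apply, Fin.ext_iff]
  omega

theorem cartan_last {i : Fin n} (h : (i : ℕ) + 1 < n) (h' : ¬ (i : ℕ) + 1 + 1 < n) :
    lroot (⟨i + 1, h⟩ : Fin n).succ (scoroot i.succ) = (-2 : ℚ) ∧
      lroot i.succ (scoroot (⟨i + 1, h⟩ : Fin n).succ) = (-1 : ℚ) := by
  rw [lroot_succ, lroot_succ, scoroot_succ, scoroot_succ]
  simp [simpleRoot, simpleCoroot, h, h', wt, eps_apply, Fin.ext_iff]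

/-- For `i < j`, the nodes are not adjacent, or `n = 1`, or they are adjacent of one of three
shapes. -/
theorem node_cases {i j : Fin (n + 1)} (h : i < j) :
    ((i : ℕ) + 1 < j) ∨ (n = 1 ∧ i = 0 ∧ j = (0 : Fin n).succ) ∨
    (1 < n ∧ i = 0 ∧ j = (0 : Fin n).succ) ∨
    (∃ (k : Fin n) (hk : (k : ℕ) + 1 < n), i = k.succ ∧ j = (⟨k + 1, hk⟩ : Fin n).succ) := by
  have h' : (i : ℕ) < j := h
  by_cases hf : (i : ℕ) + 1 < j
  · exact Or.inl hf
  right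
  have hj : (j : ℕ) = i + 1 := by omega
  have hn := NeZero.pos n
  by_cases hi : i = 0
  · have : j = (0 : Fin n).succ := by
      subst hi; apply Fin.ext; rw [hj, Fin.val_succ]; simp
    by_cases h1 : n = 1
    · exact Or.inl ⟨h1, hi, this⟩
    · exact Or.inr (Or.inl ⟨by omega, hi, this⟩)
  · right; right
    obtain ⟨k, rfl⟩ := Fin.exists_succ_eq.2 hi
    have := j.2
    simp only [Fin.val_succ] at hj
    exact ⟨k, by omega, rfl, Fin.ext (by simp [hj])⟩

/-- In rank one the diagram is that of the infinite dihedral group, and the two nodes satisfy no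
braid relation. -/
theorem cartan_one (h : n = 1) :
    lroot (0 : Fin n).succ (scoroot 0) = (-2 : ℚ) ∧
      lroot 0 (scoroot (0 : Fin n).succ) = (-2 : ℚ) := by
  subst h
  rw [lroot_zero, lroot_succ, scoroot_zero, scoroot_succ]
  simp [simpleRoot, simpleCoroot, theta, wt, eps_apply]

theorem cartan_nonpos {i j : Fin (n + 1)} (h : i ≠ j) : lroot j (scoroot i) ≤ (0 : ℚ) := by
  have key : ∀ i j : Fin (n + 1), i < j →
      lroot j (scoroot i) ≤ (0 : ℚ) ∧ lroot i (scoroot j) ≤ (0 : ℚ) := by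
    intro i j h
    rcases node_cases h with h | ⟨h1, rfl, rfl⟩ | ⟨h1, rfl, rfl⟩ | ⟨k, hk, rfl, rfl⟩
    · rw [(cartan_far h).1, (cartan_far h).2]; norm_num
    · rw [(cartan_one h1).1, (cartan_one h1).2]; norm_num
    · rw [(cartan_zero_one h1).1, (cartan_zero_one h1).2]; norm_num
    · by_cases h' : (k : ℕ) + 1 + 1 < n
      · rw [(cartan_mid hk h').1, (cartan_mid hk h').2]; norm_num
      · rw [(cartan_last hk h').1, (cartan_last hk h').2]; norm_num
  rcases lt_or_gt_of_ne h with h | h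
  · exact (key i j h).1
  · exact (key j i h).2

/-! ### Affine roots and their heights -/

/-- The affine roots: the functions `± a_p ± a_q + k` with a nonzero linear part. -/
def affRoots (n : ℕ) : Set (V n → ℚ) :=
  {φ | ∃ (p q : Fin n) (e e' : ℚ) (k : ℤ), (e = 1 ∨ e = -1) ∧ (e' = 1 ∨ e' = -1) ∧
    (p = q → e = e') ∧ φ = fun x => e * x p + e' * x q + k}

/-- The point of the fundamental alcove at which all affine simple roots take the same value. -/
def basePt (n : ℕ) : V n := fun p => (2 * ((n : ℚ) - (p : ℕ)) - 1) / (4 * n)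

theorem sroot_mem (i : Fin (n + 1)) : sroot i ∈ affRoots n := by
  refine Fin.cases ?_ (fun i => ?_) i
  · exact ⟨0, 0, -1, -1, 1, by simp, by simp, by simp, funext fun x => by
      rw [sroot_zero]; push_cast; ring⟩
  · by_cases h : (i : ℕ) + 1 < n
    · exact ⟨i, ⟨i + 1, h⟩, 1, -1, 0, by simp, by simp, by simp [Fin.ext_iff],
        funext fun x => by rw [sroot_mid h]; push_cast; ring⟩
    · exact ⟨i, i, 1, 1, 0, by simp, by simp, by simp,
        funext fun x => by rw [sroot_last h]; push_cast; ring⟩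

theorem natCast_pos' : (0 : ℚ) < n := Nat.cast_pos.2 (NeZero.pos n)

/-- The base point is ρ^∨ divided by the Coxeter number 2n. The value of an affine root there,
multiplied by 2n, is therefore its height. -/
theorem sroot_basePt (i : Fin (n + 1)) : sroot i (basePt n) = 1 / (2 * n) := by
  have hn := natCast_pos' (n := n)
  refine Fin.cases ?_ (fun i => ?_) i
  · rw [sroot_zero]
    simp only [basePt, Fin.val_zero]
    field_simp
    push_cast
    ring
  · by_cases h : (i : ℕ) + 1 < n
    · rw [sroot_mid h]
      simp only [basePt]
      field_simp
      push_cast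
      ring
    · rw [sroot_last h]
      have : (n : ℚ) = (i : ℕ) + 1 := by
        have := i.2
        exact_mod_cast (by omega : n = i + 1)
      simp only [basePt]
      rw [this] at hn ⊢
      field_simp
      ring

theorem sroot_basePt_pos (i : Fin (n + 1)) : 0 < sroot i (basePt n) := by
  have hn := natCast_pos' (n := n)
  rw [sroot_basePt]; positivity

/-- The value at the base point, in units of `1 / (2 n)`, is a nonzero integer. -/
theorem exists_height {φ : V n → ℚ} (hφ : φ ∈ affRoots n) :
    ∃ z : ℤ, z ≠ 0 ∧ φ (basePt n) = z / (2 * n) := by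
  have hn := natCast_pos' (n := n)
  obtain ⟨p, q, e, e', k, he, he', hpq, rfl⟩ := hφ
  have hp := p.2
  have hq := q.2
  rcases he with rfl | rfl <;> rcases he' with rfl | rfl
  -- The linear part has a nonzero height strictly between -2n and 2n, so adding the multiple 2nk
  -- cannot give zero. The other signs are alike.
  · refine ⟨n - p + (n - q) - 1 + 2 * n * k, fun h0 => ?_, ?_⟩
    · rcases lt_trichotomy k 0 with hk | rfl | hk
      · have : (n : ℤ) * k ≤ n * (-1) := by gcongr; omega
        linarith [(by omega : (n : ℤ) - p + (n - q) - 1 < 2 * n)]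
      · omega
      · have : (n : ℤ) * 1 ≤ n * k := by gcongr; omega
        linarith [(by omega : (0 : ℤ) < n - p + (n - q) - 1)]
    · simp only [basePt]; push_cast; field_simp; ring
  · have hne : p ≠ q := fun h => by norm_num at hpq; exact hpq h
    have hne' : (p : ℕ) ≠ q := fun h => hne (Fin.ext h)
    refine ⟨(q : ℤ) - p + 2 * n * k, fun h0 => ?_, ?_⟩
    · rcases lt_trichotomy k 0 with hk | rfl | hk
      · have : (n : ℤ) * k ≤ n * (-1) := by gcongr; omega
        linarith [(by omega : (q : ℤ) - p < 2 * n)]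
      · omega
      · have : (n : ℤ) * 1 ≤ n * k := by gcongr; omega
        linarith [(by omega : -(2 * n : ℤ) < q - p)]
    · simp only [basePt]; push_cast; field_simp; ring
  · have hne : p ≠ q := fun h => by norm_num at hpq; exact hpq h
    have hne' : (p : ℕ) ≠ q := fun h => hne (Fin.ext h)
    refine ⟨(p : ℤ) - q + 2 * n * k, fun h0 => ?_, ?_⟩
    · rcases lt_trichotomy k 0 with hk | rfl | hk
      · have : (n : ℤ) * k ≤ n * (-1) := by gcongr; omega
        linarith [(by omega : (p : ℤ) - q < 2 * n)]
      · omega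
      · have : (n : ℤ) * 1 ≤ n * k := by gcongr; omega
        linarith [(by omega : -(2 * n : ℤ) < p - q)]
    · simp only [basePt]; push_cast; field_simp; ring
  · refine ⟨-(n - p + (n - q) - 1) + 2 * n * k, fun h0 => ?_, ?_⟩
    · rcases lt_trichotomy k 0 with hk | rfl | hk
      · have : (n : ℤ) * k ≤ n * (-1) := by gcongr; omega
        linarith [(by omega : (0 : ℤ) < n - p + (n - q) - 1)]
      · omega
      · have : (n : ℤ) * 1 ≤ n * k := by gcongr; omega
        linarith [(by omega : (n : ℤ) - p + (n - q) - 1 < 2 * n)]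
    · simp only [basePt]; push_cast; field_simp; ring

theorem ne_zero_basePt {φ : V n → ℚ} (hφ : φ ∈ affRoots n) : φ (basePt n) ≠ 0 := by
  have hn := natCast_pos' (n := n)
  obtain ⟨z, hz, h⟩ := exists_height hφ
  rw [h]
  exact div_ne_zero (by exact_mod_cast hz) (by positivity)

/-- The affine roots of height one are simple. -/
theorem simple_of_height_one {φ : V n → ℚ} (hφ : φ ∈ affRoots n)
    (h : φ (basePt n) = 1 / (2 * n)) : ∃ i, φ = sroot i := by
  have hn := natCast_pos' (n := n)
  obtain ⟨p, q, e, e', k, he, he', hpq, rfl⟩ := hφ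
  have hp := p.2
  have hq := q.2
  -- Height one forces either k = 0 and a linear part of height 1, or k = 1 and a linear part of
  -- height 1 - 2n, which is -θ. Here the two signs differ, and only k = 0 is possible.
  have adj : ∀ p q : Fin n, (q : ℤ) - p + 2 * n * k = 1 →
      ∃ i, (fun x : V n => x p - x q + k) = sroot i := by
    intro p q h0
    have hp := p.2
    have hq := q.2
    have hk : k = 0 := by
      rcases lt_trichotomy k 0 with hk | rfl | hk
      · have : (n : ℤ) * k ≤ n * (-1) := by gcongr; omega
        linarith [(by omega : (q : ℤ) - p < 2 * n)]
      · rfl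
      · have : (n : ℤ) * 1 ≤ n * k := by gcongr; omega
        linarith [(by omega : -(2 * n : ℤ) + 1 < q - p)]
    subst hk
    have h1 : (q : ℕ) = p + 1 := by omega
    have h2 : (p : ℕ) + 1 < n := by omega
    refine ⟨p.succ, funext fun x => ?_⟩
    rw [sroot_mid h2, show q = ⟨p + 1, h2⟩ from Fin.ext h1]
    simp
  rcases he with rfl | rfl <;> rcases he' with rfl | rfl
  · have h0 : (n : ℤ) - p + (n - q) - 1 + 2 * n * k = 1 := by
      simp only [basePt] at h
      field_simp at h
      have : ((n : ℚ) - (p : ℕ) + (n - (q : ℕ)) - 1 + 2 * n * k) = 1 := by linarith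
      exact_mod_cast this
    have hk : k = 0 := by
      rcases lt_trichotomy k 0 with hk | rfl | hk
      · have : (n : ℤ) * k ≤ n * (-1) := by gcongr; omega
        linarith [(by omega : (n : ℤ) - p + (n - q) - 1 < 2 * n)]
      · rfl
      · have : (n : ℤ) * 1 ≤ n * k := by gcongr; omega
        linarith [(by omega : (0 : ℤ) < n - p + (n - q) - 1), (by omega : (0 : ℤ) < n)]
    subst hk
    have h1 : q = p := Fin.ext (by omega)
    subst h1
    refine ⟨q.succ, funext fun x => ?_⟩
    rw [sroot_last (by omega)]
    push_cast
    ring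
  · obtain ⟨i, hi⟩ := adj p q (by
      simp only [basePt] at h
      field_simp at h
      have : ((q : ℕ) - (p : ℕ) + 2 * n * k : ℚ) = 1 := by linarith
      exact_mod_cast this)
    exact ⟨i, hi ▸ funext fun x => by ring⟩
  · obtain ⟨i, hi⟩ := adj q p (by
      simp only [basePt] at h
      field_simp at h
      have : ((p : ℕ) - (q : ℕ) + 2 * n * k : ℚ) = 1 := by linarith
      exact_mod_cast this)
    exact ⟨i, hi ▸ funext fun x => by ring⟩
  · have h0 : -((n : ℤ) - p + (n - q) - 1) + 2 * n * k = 1 := by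
      simp only [basePt] at h
      field_simp at h
      have : (-((n : ℚ) - (p : ℕ) + (n - (q : ℕ)) - 1) + 2 * n * k) = 1 := by linarith
      exact_mod_cast this
    have hk : k = 1 := by
      rcases lt_trichotomy k 1 with hk | rfl | hk
      · have : (n : ℤ) * k ≤ n * 0 := by gcongr; omega
        linarith [(by omega : (0 : ℤ) < n - p + (n - q) - 1)]
      · rfl
      · have : (n : ℤ) * 2 ≤ n * k := by gcongr; omega
        linarith [(by omega : (n : ℤ) - p + (n - q) - 1 < 2 * n), (by omega : (0 : ℤ) < n)]
    subst hk
    have h1 : p = 0 := Fin.ext (by rw [Fin.val_zero]; omega)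
    have h2 : q = 0 := Fin.ext (by rw [Fin.val_zero]; omega)
    subst h1 h2
    refine ⟨0, funext fun x => ?_⟩
    rw [sroot_zero]
    push_cast
    ring

/-- This bounds by 2 the pairing of a root with a simple coroot, that is, the drop of height under a
simple reflection. -/
theorem scoroot_bound (i : Fin (n + 1)) (p : Fin n) :
    scoroot i p ≤ 1 ∧ -1 ≤ scoroot i p := by
  refine Fin.cases ?_ (fun i => ?_) i
  · simp only [scoroot, Fin.cases_zero, Pi.neg_apply, eps_apply]
    split_ifs <;> norm_num
  · simp only [scoroot, Fin.cases_succ, simpleCoroot]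
    split_ifs
    · simp only [Pi.sub_apply, eps_apply, Fin.ext_iff]
      split_ifs <;> first | omega | norm_num
    · simp only [eps_apply]
      split_ifs <;> norm_num

end

/-! ## Inversions and the length function -/

theorem mul_apply_aff {n : ℕ} (g h : Aff n) (x : V n) : (g * h) x = g (h x) := rfl

/-- The affine roots that are positive at `x` and negative at `y`. -/
def sep {n : ℕ} (x y : V n) : Set (V n → ℚ) := {φ | φ ∈ affRoots n ∧ 0 < φ x ∧ φ y < 0}

theorem sep_finite {n : ℕ} (x y : V n) : (sep x y).Finite := by
  have key : ∀ c : Fin n × Fin n × Bool × Bool, ({φ : V n → ℚ | ∃ k : ℤ,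
      φ = (fun x : V n => (if c.2.2.1 then 1 else -1) * x c.1 +
        (if c.2.2.2 then 1 else -1) * x c.2.1 + k) ∧ 0 < φ x ∧ φ y < 0}).Finite := by
    rintro ⟨p, q, b, b'⟩
    -- With the linear part fixed, positivity at x bounds k from below and negativity at y bounds it
    -- from above.
    refine Set.Finite.subset ((Set.finite_Icc
      ⌊-((if b then (1 : ℚ) else -1) * x p + (if b' then 1 else -1) * x q)⌋
      ⌈-((if b then (1 : ℚ) else -1) * y p + (if b' then 1 else -1) * y q)⌉).image
      fun k : ℤ => (fun x : V n => (if b then 1 else -1) * x p +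
        (if b' then 1 else -1) * x q + (k : ℚ))) ?_
    rintro φ ⟨k, rfl, h1, h2⟩
    refine ⟨k, ⟨?_, ?_⟩, rfl⟩
    · rw [← Int.cast_le (R := ℚ)]
      refine (Int.floor_le _).trans ?_
      dsimp only at h1 ⊢
      linarith
    · rw [← Int.cast_le (R := ℚ)]
      refine le_trans ?_ (Int.le_ceil _)
      dsimp only at h2 ⊢
      linarith
  refine (Set.finite_iUnion key).subset ?_
  rintro φ ⟨⟨p, q, e, e', k, he, he', -, rfl⟩, h1, h2⟩
  refine Set.mem_iUnion.2 ⟨(p, q, decide (e = 1), decide (e' = 1)), k, ?_, h1, h2⟩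
  rcases he with rfl | rfl <;> rcases he' with rfl | rfl <;> norm_num

/-- An affine automorphism preserves the affine roots. -/
def PresRoots {n : ℕ} (g : Aff n) : Prop := ∀ φ ∈ affRoots n, φ ∘ g ∈ affRoots n

theorem PresRoots.mul {n : ℕ} {g h : Aff n} (hg : PresRoots g) (hh : PresRoots h) :
    PresRoots (g * h) := fun φ hφ => hh _ (hg φ hφ)

/-- Only sums and differences of two entries of the translation enter an affine root, so all entries
may be half-integers. This generality is needed for π_n. -/
theorem presRoots_of_signedPerm {n : ℕ} {g : Aff n} (σ : Equiv.Perm (Fin n)) (e m : Fin n → ℚ)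
    (he : ∀ p, e p = 1 ∨ e p = -1) (hm : ∀ p q, ∃ a b : ℤ, m p + m q = a ∧ m p - m q = b)
    (hg : ∀ x p, g x p = e p * x (σ p) + m p) : PresRoots g := by
  rintro φ ⟨p, q, c, c', k, hc, hc', hpq, rfl⟩
  have sgn : ∀ a b : ℚ, (a = 1 ∨ a = -1) → (b = 1 ∨ b = -1) → a * b = 1 ∨ a * b = -1 := by
    rintro a b (rfl | rfl) (rfl | rfl) <;> norm_num
  obtain ⟨z, hz⟩ : ∃ z : ℤ, c * m p + c' * m q = z := by
    obtain ⟨a, b, ha, hb⟩ := hm p q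
    rcases hc with rfl | rfl <;> rcases hc' with rfl | rfl
    · exact ⟨a, by linarith⟩
    · exact ⟨b, by linarith⟩
    · exact ⟨-b, by push_cast; linarith⟩
    · exact ⟨-a, by push_cast; linarith⟩
  refine ⟨σ p, σ q, c * e p, c' * e q, z + k, sgn _ _ hc (he p), sgn _ _ hc' (he q), ?_, ?_⟩
  · intro h
    have h' := σ.injective h
    rw [hpq h', h']
  · funext x
    simp only [Function.comp_apply, hg]
    push_cast
    rw [← hz]
    ring

/-- The automorphism permutes the coordinates up to signs and integral translations. -/
def IsSignedPerm {n : ℕ} (g : Aff n) : Prop :=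
  ∃ (σ : Equiv.Perm (Fin n)) (e : Fin n → ℚ) (m : Fin n → ℤ),
    (∀ p, e p = 1 ∨ e p = -1) ∧ ∀ x p, g x p = e p * x (σ p) + m p

theorem IsSignedPerm.presRoots {n : ℕ} {g : Aff n} (h : IsSignedPerm g) : PresRoots g := by
  obtain ⟨σ, e, m, he, hg⟩ := h
  exact presRoots_of_signedPerm σ e (fun p => m p) he
    (fun p q => ⟨m p + m q, m p - m q, by push_cast; rfl, by push_cast; rfl⟩) hg

theorem IsSignedPerm.mul {n : ℕ} {g h : Aff n} (hg : IsSignedPerm g) (hh : IsSignedPerm h) :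
    IsSignedPerm (g * h) := by
  obtain ⟨σ, e, m, he, hg⟩ := hg
  obtain ⟨τ, c, l, hc, hh⟩ := hh
  refine ⟨τ * σ, fun p => e p * c (σ p), fun p => if e p = 1 then l (σ p) + m p
    else -l (σ p) + m p, fun p => ?_, fun x p => ?_⟩
  · dsimp only
    rcases he p with h | h <;> rcases hc (σ p) with h' | h' <;> rw [h, h'] <;> norm_num
  · rw [mul_apply_aff, hg, hh, Equiv.Perm.mul_apply]
    dsimp only
    rcases he p with h | h <;> rw [h]
    · rw [if_pos rfl]; push_cast; ring
    · rw [if_neg (by norm_num)]; push_cast; ring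

/-- The number of inversions of an affine automorphism. -/
def numInv {n : ℕ} (g : Aff n) : ℕ := (sep (basePt n) (g (basePt n))).ncard

theorem numInv_one {n : ℕ} : numInv (1 : Aff n) = 0 := by
  rw [numInv]
  convert Set.ncard_empty (V n → ℚ)
  ext φ
  simp only [sep, Set.mem_ofPred_eq, Set.mem_empty_iff_false, iff_false, not_and, not_lt]
  exact fun _ h => h.le

section
variable {n : ℕ} [NeZero n]

theorem isSignedPerm_simpleRefl (i : Fin (n + 1)) : IsSignedPerm (simpleRefl i : Aff n) := by
  refine Fin.cases ?_ (fun i => ?_) i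
  · refine ⟨1, fun p => if p = 0 then -1 else 1, fun p => if p = 0 then 1 else 0, fun p => ?_,
      fun x p => ?_⟩
    · dsimp only
      split_ifs <;> simp
    · rw [simpleRefl_apply, sroot_zero, scoroot_zero]
      simp only [Pi.sub_apply, Pi.smul_apply, Pi.neg_apply, eps_apply, smul_eq_mul,
        Equiv.Perm.one_apply]
      split_ifs with h
      · subst h; push_cast; ring
      · push_cast; ring
  · by_cases h : (i : ℕ) + 1 < n
    · refine ⟨Equiv.swap i ⟨i + 1, h⟩, fun _ => 1, fun _ => 0, fun p => Or.inl rfl, fun x p => ?_⟩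
      rw [simpleRefl_apply, sroot_mid h, scoroot_succ]
      simp only [simpleCoroot, h, dif_pos, Pi.sub_apply, Pi.smul_apply, eps_apply, smul_eq_mul]
      have hne : i ≠ ⟨i + 1, h⟩ := by simp [Fin.ext_iff]
      by_cases h1 : p = i
      · subst h1
        rw [Equiv.swap_apply_left]
        simp [hne]
      · by_cases h2 : p = ⟨i + 1, h⟩
        · subst h2
          rw [Equiv.swap_apply_right]
          simp [hne.symm]
        · rw [Equiv.swap_apply_of_ne_of_ne h1 h2]
          simp [h1, h2]
    · refine ⟨1, fun p => if p = i then -1 else 1, fun p => 0, fun p => ?_, fun x p => ?_⟩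
      · dsimp only
        split_ifs <;> simp
      · rw [simpleRefl_apply, sroot_last h, scoroot_succ]
        simp only [simpleCoroot, h, dif_neg, not_false_eq_true, Pi.sub_apply, Pi.smul_apply,
          eps_apply, smul_eq_mul, Equiv.Perm.one_apply]
        split_ifs with h'
        · subst h'; push_cast; ring
        · push_cast; ring

theorem isSignedPerm_of_mem {w : Aff n} (hw : w ∈ Waf n) : IsSignedPerm w := by
  obtain ⟨ω, rfl⟩ := exists_word hw
  induction ω with
  | nil => exact ⟨1, fun _ => 1, fun _ => 0, fun _ => Or.inl rfl, fun x p => by simp [wordProd]⟩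
  | cons i ω ih =>
    rw [wordProd_cons]
    exact (isSignedPerm_simpleRefl i).mul (ih (wordProd_mem ω))

theorem presRoots_of_mem {w : Aff n} (hw : w ∈ Waf n) : PresRoots w :=
  (isSignedPerm_of_mem hw).presRoots

theorem presRoots_simpleRefl (i : Fin (n + 1)) : PresRoots (simpleRefl i : Aff n) :=
  presRoots_of_mem (simpleRefl_mem i)

/-- The simple reflection `s_i` sends only one positive affine root to a negative one. -/
theorem eq_sroot_of_neg {φ : V n → ℚ} (hφ : φ ∈ affRoots n) {i : Fin (n + 1)}
    (h0 : 0 < φ (basePt n)) (h1 : φ (simpleRefl i (basePt n)) < 0) : φ = sroot i := by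
  have hn := natCast_pos' (n := n)
  obtain ⟨z, hz, hz'⟩ := exists_height hφ
  obtain ⟨y, hy, hy'⟩ := exists_height (presRoots_simpleRefl i φ hφ)
  rw [Function.comp_apply] at hy'
  have hzpos : 0 < z := by
    rw [hz'] at h0
    have := (div_pos_iff_of_pos_right (by positivity : (0 : ℚ) < 2 * n)).1 h0
    exact_mod_cast this
  have hyneg : y < 0 := by
    rw [hy'] at h1
    by_contra hle
    have : (0 : ℚ) ≤ y := by exact_mod_cast not_lt.1 hle
    exact absurd h1 (not_lt.2 (by positivity))
  -- The reflection moves the base point by a coroot divided by 2n, so z - y is the pairing of the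
  -- root with that coroot. With y < 0 < z this leaves only z = 1.
  have hdiff : (z : ℚ) - y ≤ 2 := by
    obtain ⟨p, q, e, e', k, he, he', hpq, rfl⟩ := hφ
    rw [simpleRefl_apply, sroot_basePt] at hy'
    simp only [Pi.sub_apply, Pi.smul_apply, smul_eq_mul] at hy' hz'
    have h2 : ((z : ℚ) - y) / (2 * n) = (e * scoroot i p + e' * scoroot i q) / (2 * n) := by
      rw [sub_div, ← hz', ← hy']; ring
    have h3 := (div_left_inj' (by positivity : (2 * n : ℚ) ≠ 0)).1 h2
    rw [h3]
    have hp := scoroot_bound i p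
    have hq := scoroot_bound i q
    rcases he with rfl | rfl <;> rcases he' with rfl | rfl <;> linarith
  have hdiff' : z - y ≤ 2 := by exact_mod_cast hdiff
  have hz1 : z = 1 := by omega
  subst hz1
  obtain ⟨j, rfl⟩ := simple_of_height_one hφ (by rw [hz']; simp)
  -- The pairing of two distinct simple roots is nonpositive, so the value of α_j could not decrease
  -- under s_i.
  by_contra hne
  have hij : i ≠ j := by rintro rfl; exact hne rfl
  rw [sroot_simpleRefl] at h1
  have := mul_nonneg (neg_nonneg.2 (cartan_nonpos hij)) (sroot_basePt_pos (n := n) i).le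
  linarith

/-- Composition with s_i is an involution of the affine roots, and α_i is the only positive one that
it makes negative. It therefore matches the inversions of w with those of s_i w other than α_i,
while α_i becomes a new inversion. -/
theorem numInv_simpleRefl_mul {w : Aff n} {i : Fin (n + 1)} (h : 0 < sroot i (w (basePt n))) :
    numInv (simpleRefl i * w) = numInv w + 1 := by
  have hset : sep (basePt n) ((simpleRefl i * w) (basePt n)) =
      insert (sroot i)
        ((fun φ : V n → ℚ => φ ∘ simpleRefl i) '' sep (basePt n) (w (basePt n))) := by
    ext φ
    constructor
    · rintro ⟨hφ, h1, h2⟩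
      by_cases hφi : φ = sroot i
      · exact Or.inl hφi
      · refine Or.inr ⟨φ ∘ simpleRefl i, ⟨presRoots_simpleRefl i φ hφ, ?_, h2⟩, ?_⟩
        · rcases lt_or_gt_of_ne (ne_zero_basePt (presRoots_simpleRefl i φ hφ)) with h3 | h3
          · exact absurd (eq_sroot_of_neg hφ h1 h3) hφi
          · exact h3
        · funext x
          simp only [Function.comp_apply, simpleRefl_simpleRefl]
    · rintro (rfl | ⟨ψ, ⟨hψ, h1, h2⟩, rfl⟩)
      · refine ⟨sroot_mem i, sroot_basePt_pos i, ?_⟩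
        rw [mul_apply_aff, sroot_simpleRefl_self]
        linarith
      · refine ⟨presRoots_simpleRefl i ψ hψ, ?_, ?_⟩
        · rcases lt_or_gt_of_ne (ne_zero_basePt (presRoots_simpleRefl i ψ hψ)) with h3 | h3
          · have := eq_sroot_of_neg hψ h1 h3
            subst this
            exact absurd h2 (not_lt.2 h.le)
          · exact h3
        · simpa only [Function.comp_apply, mul_apply_aff, simpleRefl_simpleRefl] using h2
  rw [numInv, hset, Set.ncard_insert_of_notMem ?_ ((sep_finite _ _).image _),
    Set.ncard_image_of_injective]
  · rfl
  · intro φ ψ hφψ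
    funext x
    have := congrFun hφψ (simpleRefl i x)
    simpa only [Function.comp_apply, simpleRefl_simpleRefl] using this
  · rintro ⟨ψ, ⟨-, h1, -⟩, h2⟩
    have := congrFun h2 (simpleRefl i (basePt n))
    simp only [Function.comp_apply, simpleRefl_simpleRefl, sroot_simpleRefl_self] at this
    have := sroot_basePt_pos (n := n) i
    linarith

theorem numInv_simpleRefl_mul_of_neg {w : Aff n} {i : Fin (n + 1)}
    (h : sroot i (w (basePt n)) < 0) : numInv (simpleRefl i * w) + 1 = numInv w := by
  rw [← numInv_simpleRefl_mul (w := simpleRefl i * w) (i := i), ← mul_assoc,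
    simpleRefl_mul_self, one_mul]
  rw [mul_apply_aff, sroot_simpleRefl_self]
  linarith

/-! ### The fundamental alcove -/

theorem alcove_bounds {y : V n} (h : ∀ i, 0 < sroot i y) :
    (∀ p, 0 < y p ∧ y p < 1 / 2) ∧ ∀ p q, p < q → y q < y p := by
  have hstep : ∀ (d k : ℕ) (hk : k + d + 1 < n), y ⟨k + d + 1, hk⟩ < y ⟨k, by omega⟩ := by
    intro d
    induction d with
    | zero =>
      intro k hk
      have := h (⟨k, by omega⟩ : Fin n).succ
      rw [sroot_mid hk] at this
      simpa using this
    | succ d ih =>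
      intro k hk
      have h1 := ih k (by omega)
      have := h (⟨k + d + 1, by omega⟩ : Fin n).succ
      rw [sroot_mid (by exact hk)] at this
      dsimp only at this
      exact lt_trans (sub_pos.1 this) h1
  have hanti : ∀ p q : Fin n, p < q → y q < y p := by
    rintro ⟨p, hp⟩ ⟨q, hq⟩ hpq
    obtain ⟨d, rfl⟩ := Nat.exists_eq_add_of_lt (show p < q from hpq)
    exact hstep d p hq
  have hn := NeZero.pos n
  refine ⟨fun p => ⟨?_, ?_⟩, hanti⟩
  · have h1 := h (⟨n - 1, by omega⟩ : Fin n).succ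
    rw [sroot_last (by simp; omega)] at h1
    rcases eq_or_ne p ⟨n - 1, by omega⟩ with rfl | hp
    · linarith
    · have hp' : (p : ℕ) ≠ n - 1 := fun h => hp (Fin.ext h)
      have := hanti p ⟨n - 1, by omega⟩ (by rw [Fin.lt_def]; dsimp only; omega)
      linarith
  · have h1 := h 0
    rw [sroot_zero] at h1
    rcases eq_or_ne p 0 with rfl | hp
    · linarith
    · have := hanti 0 p (Fin.pos_iff_ne_zero.2 hp)
      linarith

/-- Coordinates in (0, 1/2) leave no room for a sign change or an integral shift, and their
decreasing order then forces the permutation to be trivial. Integrality is essential, since π_n also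
preserves the alcove. -/
theorem eq_one_of_alcove {w : Aff n} (hw : w ∈ Waf n) (h : ∀ i, 0 < sroot i (w (basePt n))) :
    w = 1 := by
  obtain ⟨hy, hy'⟩ := alcove_bounds h
  obtain ⟨hx, hx'⟩ := alcove_bounds (sroot_basePt_pos (n := n))
  obtain ⟨σ, e, m, he, hg⟩ := isSignedPerm_of_mem hw
  have hem : ∀ p, e p = 1 ∧ m p = 0 := by
    intro p
    have h1 := hy p
    have h2 := hx (σ p)
    rw [hg] at h1
    rcases he p with h | h <;> rw [h] at h1 ⊢
    · have : (-1 : ℚ) < m p := by linarith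
      have : (-1 : ℤ) < m p := by exact_mod_cast this
      have : (m p : ℚ) < 1 := by linarith
      have : m p < 1 := by exact_mod_cast this
      exact ⟨rfl, by omega⟩
    · have : (0 : ℚ) < m p := by linarith
      have : (0 : ℤ) < m p := by exact_mod_cast this
      have : (m p : ℚ) < 1 := by linarith
      have : m p < 1 := by exact_mod_cast this
      omega
  have hwx : ∀ x p, w x p = x (σ p) := by
    intro x p
    rw [hg, (hem p).1, (hem p).2]
    simp
  have hmono : StrictMono σ := by
    intro p q hpq
    by_contra hle
    have h1 := hy' p q hpq
    rw [hwx, hwx] at h1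
    rcases eq_or_lt_of_le (not_lt.1 hle) with h2 | h2
    · rw [h2] at h1; exact lt_irrefl _ h1
    · exact lt_asymm h1 (hx' _ _ h2)
  have hid : σ = 1 := by
    ext1 p
    have : (hmono.orderIsoOfSurjective σ σ.surjective) = OrderIso.refl _ := Subsingleton.elim _ _
    exact DFunLike.congr_fun this p
  ext x p
  rw [hwx, hid]
  rfl

/-! ### Length and inversions -/

theorem len_le_length (ω : List (Fin (n + 1))) : len (wordProd ω : Aff n) ≤ ω.length :=
  Nat.sInf_le ⟨ω, rfl, rfl⟩

theorem sroot_ne_zero_of_mem {w : Aff n} (hw : w ∈ Waf n) (i : Fin (n + 1)) :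
    sroot i (w (basePt n)) ≠ 0 :=
  ne_zero_basePt (presRoots_of_mem hw _ (sroot_mem i))

theorem numInv_wordProd_le (ω : List (Fin (n + 1))) : numInv (wordProd ω : Aff n) ≤ ω.length := by
  induction ω with
  | nil => exact numInv_one.le
  | cons i ω ih =>
    rw [wordProd_cons, List.length_cons]
    rcases lt_or_gt_of_ne (sroot_ne_zero_of_mem (wordProd_mem ω) i) with h | h
    · have := numInv_simpleRefl_mul_of_neg h
      omega
    · rw [numInv_simpleRefl_mul h]
      omega

/-- Multiplying by a descent removes one inversion, and an element without descents is the identity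
because it keeps the base point in the alcove. -/
theorem len_le_numInv : ∀ (k : ℕ) {w : Aff n}, w ∈ Waf n → numInv w = k → len w ≤ k := by
  intro k
  induction k with
  | zero =>
    intro w hw hk
    have : w = 1 := eq_one_of_alcove hw fun i => by
      rcases lt_or_gt_of_ne (sroot_ne_zero_of_mem hw i) with h | h
      · have := numInv_simpleRefl_mul_of_neg h
        omega
      · exact h
    subst this
    exact len_le_length []
  | succ k ih =>
    intro w hw hk
    obtain ⟨i, hi⟩ : ∃ i, sroot i (w (basePt n)) < 0 := by
      by_contra! hcon
      have h0 : w = 1 := eq_one_of_alcove hw fun i =>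
        lt_of_le_of_ne (hcon i) (sroot_ne_zero_of_mem hw i).symm
      rw [h0, numInv_one] at hk
      omega
    have h1 := numInv_simpleRefl_mul_of_neg hi
    have hmem := (Waf n).mul_mem (simpleRefl_mem i) hw
    have h2 := ih hmem (by omega)
    obtain ⟨ω, hω, hlen⟩ := exists_reduced hmem
    have h3 : wordProd (i :: ω) = w := by
      rw [wordProd_cons, hω, ← mul_assoc, simpleRefl_mul_self, one_mul]
    have := len_le_length (i :: ω)
    rw [h3, List.length_cons] at this
    omega

theorem len_eq_numInv {w : Aff n} (hw : w ∈ Waf n) : len w = numInv w := by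
  refine le_antisymm (len_le_numInv _ hw rfl) ?_
  obtain ⟨ω, rfl, hl⟩ := exists_reduced hw
  rw [← hl]
  exact numInv_wordProd_le ω

theorem len_simpleRefl_mul {w : Aff n} (hw : w ∈ Waf n) {i : Fin (n + 1)}
    (h : 0 < sroot i (w (basePt n))) : len (simpleRefl i * w) = len w + 1 := by
  rw [len_eq_numInv hw, len_eq_numInv ((Waf n).mul_mem (simpleRefl_mem i) hw),
    numInv_simpleRefl_mul h]

theorem len_simpleRefl_mul_of_neg {w : Aff n} (hw : w ∈ Waf n) {i : Fin (n + 1)}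
    (h : sroot i (w (basePt n)) < 0) : len (simpleRefl i * w) + 1 = len w := by
  rw [len_eq_numInv hw, len_eq_numInv ((Waf n).mul_mem (simpleRefl_mem i) hw),
    numInv_simpleRefl_mul_of_neg h]

end

/-! ## Braid relations and reduced words -/

section
variable {M : Type*} [AddCommGroup M] [Module ℚ M] {α β : M → ℚ} {c d : M} {s t : M → M}

/-- In this and the next two identities α and β are arbitrary functions, not linear forms, so that
affine reflections and their linear parts are covered at once. -/
theorem braid_two (hs : ∀ x, s x = x - α x • c) (ht : ∀ x, t x = x - β x • d)
    (hαt : ∀ x, α (t x) = α x) (hβs : ∀ x, β (s x) = β x) (x : M) :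
    s (t x) = t (s x) := by
  rw [hs (t x), ht (s x), hαt, hβs, hs, ht]
  abel

theorem braid_three (hs : ∀ x, s x = x - α x • c) (ht : ∀ x, t x = x - β x • d)
    (hαs : ∀ x, α (s x) = -α x) (hβt : ∀ x, β (t x) = -β x)
    (hαt : ∀ x, α (t x) = α x + β x) (hβs : ∀ x, β (s x) = β x + α x) (x : M) :
    s (t (s x)) = t (s (t x)) := by
  have e1 : β (s x) = β x + α x := hβs x
  have e2 : α (t (s x)) = β x := by simp only [hαt, hαs, hβs]; ring
  have e3 : β (s (t x)) = α x := by simp only [hαt, hβt, hβs]; ring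
  rw [hs (t (s x)), e2, ht (s x), e1, hs x, ht (s (t x)), e3, hs (t x), hαt, ht x]
  module

theorem braid_four (hs : ∀ x, s x = x - α x • c) (ht : ∀ x, t x = x - β x • d)
    (hαs : ∀ x, α (s x) = -α x) (hβt : ∀ x, β (t x) = -β x)
    (hαt : ∀ x, α (t x) = α x + 2 * β x) (hβs : ∀ x, β (s x) = β x + α x) (x : M) :
    s (t (s (t x))) = t (s (t (s x))) := by
  have e1 : β (s (t x)) = α x + β x := by simp only [hαt, hβt, hβs]; ring
  have e2 : α (t (s (t x))) = α x := by simp only [hαt, hβt, hβs, hαs]; ring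
  have e3 : α (t (s x)) = α x + 2 * β x := by simp only [hαt, hβs, hαs]; ring
  have e4 : β (s (t (s x))) = β x := by simp only [hαt, hβt, hβs, hαs]; ring
  rw [hs (t (s (t x))), e2, ht (s (t x)), e1, hs (t x), hαt, ht x, ht (s (t (s x))), e4,
    hs (t (s x)), e3, ht (s x), hβs, hs x]
  module

end

/-! ### Matsumoto's theorem for the affine Weyl group -/

section
variable {n : ℕ} [NeZero n]

/-- A family of operators satisfies the braid relations of the affine Dynkin diagram. -/
structure BraidRels {M : Type*} (A : Fin (n + 1) → M → M) : Prop where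
  two : ∀ {i j}, lroot j (scoroot i) = (0 : ℚ) → lroot i (scoroot j) = (0 : ℚ) →
    ∀ f, A i (A j f) = A j (A i f)
  three : ∀ {i j}, lroot j (scoroot i) = (-1 : ℚ) → lroot i (scoroot j) = (-1 : ℚ) →
    ∀ f, A i (A j (A i f)) = A j (A i (A j f))
  four : ∀ {i j}, lroot j (scoroot i) = (-1 : ℚ) → lroot i (scoroot j) = (-2 : ℚ) →
    ∀ f, A i (A j (A i (A j f))) = A j (A i (A j (A i f)))

theorem braidRels_of_reflection {α : Fin (n + 1) → V n → ℚ} {s : Fin (n + 1) → V n → V n}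
    (hs : ∀ i x, s i x = x - α i x • scoroot i)
    (hα : ∀ i j x, α j (s i x) = α j x - lroot j (scoroot i) * α i x) : BraidRels s where
  two h h' f := braid_two (hs _) (hs _) (fun x => by rw [hα, h']; ring)
    (fun x => by rw [hα, h]; ring) f
  three h h' f := braid_three (hs _) (hs _) (fun x => by rw [hα, lroot_scoroot_self]; ring)
    (fun x => by rw [hα, lroot_scoroot_self]; ring) (fun x => by rw [hα, h']; ring)
    (fun x => by rw [hα, h]; ring) f
  four h h' f := braid_four (hs _) (hs _) (fun x => by rw [hα, lroot_scoroot_self]; ring)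
    (fun x => by rw [hα, lroot_scoroot_self]; ring) (fun x => by rw [hα, h']; ring)
    (fun x => by rw [hα, h]; ring) f

theorem braidRels_simpleRefl : BraidRels fun (i : Fin (n + 1)) (x : V n) => simpleRefl i x :=
  braidRels_of_reflection simpleRefl_apply sroot_simpleRefl

/-- The last alternative is the infinite dihedral case n = 1. No braid relation is needed there,
because two roots with sum 1 are never both negative at a point. -/
theorem cartan_cases {i j : Fin (n + 1)} (h : i ≠ j) :
    (lroot j (scoroot i) = (0 : ℚ) ∧ lroot i (scoroot j) = (0 : ℚ)) ∨
    (lroot j (scoroot i) = (-1 : ℚ) ∧ lroot i (scoroot j) = (-1 : ℚ)) ∨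
    (lroot j (scoroot i) = (-1 : ℚ) ∧ lroot i (scoroot j) = (-2 : ℚ)) ∨
    (lroot j (scoroot i) = (-2 : ℚ) ∧ lroot i (scoroot j) = (-1 : ℚ)) ∨
    (∀ x : V n, sroot i x + sroot j x = 1) := by
  have key : ∀ i j : Fin (n + 1), i < j →
      (lroot j (scoroot i) = (0 : ℚ) ∧ lroot i (scoroot j) = (0 : ℚ)) ∨
      (lroot j (scoroot i) = (-1 : ℚ) ∧ lroot i (scoroot j) = (-1 : ℚ)) ∨
      (lroot j (scoroot i) = (-1 : ℚ) ∧ lroot i (scoroot j) = (-2 : ℚ)) ∨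
      (lroot j (scoroot i) = (-2 : ℚ) ∧ lroot i (scoroot j) = (-1 : ℚ)) ∨
      (∀ x : V n, sroot i x + sroot j x = 1) := by
    intro i j h
    rcases node_cases h with h | ⟨h1, rfl, rfl⟩ | ⟨h1, rfl, rfl⟩ | ⟨k, hk, rfl, rfl⟩
    · exact Or.inl (cartan_far h)
    · refine Or.inr (Or.inr (Or.inr (Or.inr fun x => ?_)))
      rw [sroot_zero, sroot_last (by simp [h1])]
      ring
    · exact Or.inr (Or.inr (Or.inl (cartan_zero_one h1)))
    · by_cases h' : (k : ℕ) + 1 + 1 < n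
      · exact Or.inr (Or.inl (cartan_mid hk h'))
      · exact Or.inr (Or.inr (Or.inr (Or.inl (cartan_last hk h'))))
  rcases lt_or_gt_of_ne h with h | h
  · exact key i j h
  · rcases key j i h with h | h | h | h | h
    · exact Or.inl h.symm
    · exact Or.inr (Or.inl h.symm)
    · exact Or.inr (Or.inr (Or.inr (Or.inl h.symm)))
    · exact Or.inr (Or.inr (Or.inl h.symm))
    · exact Or.inr (Or.inr (Or.inr (Or.inr fun x => by rw [add_comm]; exact h x)))

/-- A word of minimal length. -/
def IsReducedWord (ω : List (Fin (n + 1))) : Prop := ω.length = len (wordProd ω : Aff n)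

theorem IsReducedWord.neg_of_cons {i : Fin (n + 1)} {ω : List (Fin (n + 1))}
    (h : IsReducedWord (i :: ω)) : sroot i ((wordProd (i :: ω) : Aff n) (basePt n)) < 0 := by
  rcases lt_or_gt_of_ne (sroot_ne_zero_of_mem (wordProd_mem (i :: ω)) i) with h1 | h1
  · exact h1
  · exfalso
    have h2 := len_simpleRefl_mul (wordProd_mem (i :: ω)) h1
    have h3 : (simpleRefl i * wordProd (i :: ω) : Aff n) = wordProd ω := by
      rw [wordProd_cons, ← mul_assoc, simpleRefl_mul_self, one_mul]
    rw [h3, ← h] at h2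
    have := len_le_length (n := n) ω
    rw [List.length_cons] at h2
    omega

theorem IsReducedWord.tail {i : Fin (n + 1)} {ω : List (Fin (n + 1))}
    (h : IsReducedWord (i :: ω)) : IsReducedWord ω := by
  have h1 := len_simpleRefl_mul_of_neg (wordProd_mem (i :: ω)) h.neg_of_cons
  have h3 : (simpleRefl i * wordProd (i :: ω) : Aff n) = wordProd ω := by
    rw [wordProd_cons, ← mul_assoc, simpleRefl_mul_self, one_mul]
  rw [h3, ← h, List.length_cons] at h1
  rw [IsReducedWord]
  omega

theorem IsReducedWord.cons {i : Fin (n + 1)} {ω : List (Fin (n + 1))} (h : IsReducedWord ω)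
    (hi : 0 < sroot i ((wordProd ω : Aff n) (basePt n))) : IsReducedWord (i :: ω) := by
  rw [IsReducedWord, wordProd_cons, len_simpleRefl_mul (wordProd_mem ω) hi, List.length_cons, h]

/-- A reduced word starting with a given descent, with the remaining word arbitrary. -/
theorem exists_reduced_descents {w : Aff n} (hw : w ∈ Waf n) (τ : List (Fin (n + 1)))
    (h : ∀ σ i σ', τ = σ ++ i :: σ' → sroot i ((wordProd σ.reverse * w) (basePt n)) < 0) :
    ∃ ω, IsReducedWord (τ ++ ω) ∧ wordProd (τ ++ ω) = w := by
  induction τ generalizing w with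
  | nil =>
    obtain ⟨ω, hω, hl⟩ := exists_reduced hw
    exact ⟨ω, by rw [IsReducedWord, List.nil_append, hl, hω], hω⟩
  | cons i τ ih =>
    have hi := h [] i τ rfl
    rw [List.reverse_nil, show (wordProd [] : Aff n) = 1 from rfl, one_mul] at hi
    obtain ⟨ω, h1, h2⟩ := ih ((Waf n).mul_mem (simpleRefl_mem i) hw) (fun σ j σ' hσ => by
      have := h (i :: σ) j σ' (by rw [hσ]; rfl)
      rwa [List.reverse_cons, wordProd_append, mul_assoc, show
        (wordProd [i] : Aff n) = simpleRefl i by simp [wordProd]] at this)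
    refine ⟨ω, ?_, ?_⟩
    · refine h1.cons ?_
      rw [h2, mul_apply_aff, sroot_simpleRefl_self]
      linarith
    · rw [List.cons_append, wordProd_cons, h2, ← mul_assoc, simpleRefl_mul_self, one_mul]

/-- Operators that satisfy the braid relations have the same product along two reduced words of
the same element. -/
theorem BraidRels.foldr_eq {M : Type*} {A : Fin (n + 1) → M → M} (hA : BraidRels A) :
    ∀ (l : ℕ) (ω ω' : List (Fin (n + 1))), ω.length = l → IsReducedWord ω → IsReducedWord ω' →
      (wordProd ω : Aff n) = wordProd ω' → ∀ f, ω.foldr A f = ω'.foldr A f := by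
  intro l
  induction l with
  | zero =>
    intro ω ω' hl h h' hw f
    have : ω'.length = 0 := by rw [h', ← hw, ← h, hl]
    rw [List.length_eq_zero_iff.1 hl, List.length_eq_zero_iff.1 this]
  | succ l ih =>
    intro ω ω' hl h h' hw f
    have hl' : ω'.length = l + 1 := by rw [h', ← hw, ← h, hl]
    obtain ⟨i, ω, rfl⟩ := List.exists_cons_of_length_eq_add_one hl
    obtain ⟨j, ω', rfl⟩ := List.exists_cons_of_length_eq_add_one hl'
    rw [List.length_cons, Nat.add_right_cancel_iff] at hl hl'
    have cancel : ∀ (k : Fin (n + 1)) {x y : Aff n}, simpleRefl k * x = simpleRefl k * y →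
        x = y := fun k _ _ h => mul_left_cancel h
    by_cases hij : i = j
    · subst hij
      rw [wordProd_cons, wordProd_cons] at hw
      rw [List.foldr_cons, List.foldr_cons, ih ω ω' hl h.tail h'.tail (cancel i hw)]
    -- it is enough to find reduced words that start with `i` and `j` and give the same operator
    suffices hs : ∃ τ τ' : List (Fin (n + 1)), IsReducedWord (i :: τ) ∧ IsReducedWord (j :: τ') ∧
        (wordProd (i :: τ) : Aff n) = wordProd (i :: ω) ∧
        (wordProd (j :: τ') : Aff n) = wordProd (i :: ω) ∧
        (i :: τ).foldr A f = (j :: τ').foldr A f by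
      obtain ⟨τ, τ', h1, h2, h3, h4, h5⟩ := hs
      rw [List.foldr_cons] at h5
      rw [List.foldr_cons, List.foldr_cons,
        ih ω τ hl h.tail h1.tail (cancel i (by rw [← wordProd_cons, ← wordProd_cons, h3])),
        ih ω' τ' hl' h'.tail h2.tail (cancel j (by rw [← wordProd_cons, ← wordProd_cons, h4, hw])),
        h5, List.foldr_cons]
    have hi := h.neg_of_cons
    have hj := h'.neg_of_cons
    rw [← hw] at hj
    generalize hwdef : (wordProd (i :: ω) : Aff n) = w at hi hj ⊢
    have hmem : w ∈ Waf n := hwdef ▸ wordProd_mem _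
    have hmul : ∀ (k : Fin (n + 1)) (x : V n), (wordProd [k] : Aff n) x = simpleRefl k x := by
      intro k x; simp [wordProd]
    have red : ∀ (τ τ' ρ : List (Fin (n + 1))), IsReducedWord (τ ++ ρ) →
        (wordProd (τ ++ ρ) : Aff n) = w → τ.length = τ'.length →
        (wordProd τ : Aff n) = wordProd τ' →
        IsReducedWord (τ' ++ ρ) ∧ (wordProd (τ' ++ ρ) : Aff n) = w := by
      intro τ τ' ρ h1 h2 h3 h4
      have h5 : (wordProd (τ' ++ ρ) : Aff n) = wordProd (τ ++ ρ) := by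
        rw [wordProd_append, wordProd_append, h4]
      refine ⟨?_, h5.trans h2⟩
      rw [IsReducedWord, h5, ← h1, List.length_append, List.length_append, h3]
    have hB := braidRels_simpleRefl (n := n)
    -- Stripping the letters in turn evaluates at w(x₀), x₀ the base point, the positive roots of
    -- the rank two subsystem. They are nonnegative combinations of α_i and α_j, both negative
    -- there, so each letter is a descent. Quantifying over i and j lets one argument serve both
    -- orders of the Cartan entries -1 and -2.
    have four : ∀ i j : Fin (n + 1), sroot i (w (basePt n)) < 0 → sroot j (w (basePt n)) < 0 →
        lroot j (scoroot i) = (-1 : ℚ) → lroot i (scoroot j) = (-2 : ℚ) →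
        ∃ ρ, IsReducedWord ([i, j, i, j] ++ ρ) ∧ IsReducedWord ([j, i, j, i] ++ ρ) ∧
        (wordProd ([i, j, i, j] ++ ρ) : Aff n) = w ∧ wordProd ([j, i, j, i] ++ ρ) = w ∧
        ([i, j, i, j] ++ ρ).foldr A f = ([j, i, j, i] ++ ρ).foldr A f := by
      intro i j hi hj ha hb
      obtain ⟨ρ, h1, h2⟩ := exists_reduced_descents hmem [i, j, i, j] (by
        rintro (_ | ⟨a, _ | ⟨b, _ | ⟨c, _ | ⟨d, σ⟩⟩⟩⟩) k σ' hσ <;>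
          simp only [List.nil_append, List.cons_append, List.cons.injEq] at hσ
        · obtain ⟨rfl, -⟩ := hσ
          exact hi
        · obtain ⟨rfl, rfl, -⟩ := hσ
          simp only [wordProd, List.reverse_cons, List.reverse_nil, List.nil_append, List.map_cons,
            List.map_nil, List.prod_cons, List.prod_nil, mul_one, mul_apply_aff,
            sroot_simpleRefl, ha]
          linarith
        · obtain ⟨rfl, rfl, rfl, -⟩ := hσ
          simp only [wordProd, List.reverse_cons, List.reverse_nil, List.nil_append, List.map_cons,
            List.cons_append, List.map_nil, List.prod_cons, List.prod_nil, mul_one, mul_apply_aff,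
            sroot_simpleRefl, lroot_scoroot_self, ha, hb]
          linarith
        · obtain ⟨rfl, rfl, rfl, rfl, -⟩ := hσ
          simp only [wordProd, List.reverse_cons, List.reverse_nil, List.nil_append, List.map_cons,
            List.cons_append, List.map_nil, List.prod_cons, List.prod_nil, mul_one, mul_apply_aff,
            sroot_simpleRefl, lroot_scoroot_self, ha, hb]
          linarith
        · simp at hσ)
      obtain ⟨h3, h4⟩ := red [i, j, i, j] [j, i, j, i] ρ h1 h2 rfl (AffineEquiv.ext fun x => by
        simpa [wordProd, mul_apply_aff] using hB.four ha hb x)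
      exact ⟨ρ, h1, h3, h2, h4, hA.four ha hb _⟩
    rcases cartan_cases hij with ⟨ha, hb⟩ | ⟨ha, hb⟩ | ⟨ha, hb⟩ | ⟨ha, hb⟩ | hsum
    · obtain ⟨ρ, h1, h2⟩ := exists_reduced_descents hmem [i, j] (by
        rintro (_ | ⟨a, _ | ⟨b, σ⟩⟩) k σ' hσ <;>
          simp only [List.nil_append, List.cons_append, List.cons.injEq] at hσ
        · obtain ⟨rfl, -⟩ := hσ
          exact hi
        · obtain ⟨rfl, rfl, -⟩ := hσ
          simp only [wordProd, List.reverse_cons, List.reverse_nil, List.nil_append, List.map_cons,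
            List.map_nil, List.prod_cons, List.prod_nil, mul_one, mul_apply_aff,
            sroot_simpleRefl, ha]
          linarith
        · simp at hσ)
      obtain ⟨h3, h4⟩ := red [i, j] [j, i] ρ h1 h2 rfl (AffineEquiv.ext fun x => by
        simpa [wordProd, mul_apply_aff] using hB.two ha hb x)
      exact ⟨j :: ρ, i :: ρ, h1, h3, h2, h4, hA.two ha hb _⟩
    · obtain ⟨ρ, h1, h2⟩ := exists_reduced_descents hmem [i, j, i] (by
        rintro (_ | ⟨a, _ | ⟨b, _ | ⟨c, σ⟩⟩⟩) k σ' hσ <;>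
          simp only [List.nil_append, List.cons_append, List.cons.injEq] at hσ
        · obtain ⟨rfl, -⟩ := hσ
          exact hi
        · obtain ⟨rfl, rfl, -⟩ := hσ
          simp only [wordProd, List.reverse_cons, List.reverse_nil, List.nil_append, List.map_cons,
            List.map_nil, List.prod_cons, List.prod_nil, mul_one, mul_apply_aff,
            sroot_simpleRefl, ha]
          linarith
        · obtain ⟨rfl, rfl, rfl, -⟩ := hσ
          simp only [wordProd, List.reverse_cons, List.reverse_nil, List.nil_append, List.map_cons,
            List.cons_append, List.map_nil, List.prod_cons, List.prod_nil, mul_one, mul_apply_aff,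
            sroot_simpleRefl, lroot_scoroot_self, ha, hb]
          linarith
        · simp at hσ)
      obtain ⟨h3, h4⟩ := red [i, j, i] [j, i, j] ρ h1 h2 rfl (AffineEquiv.ext fun x => by
        simpa [wordProd, mul_apply_aff] using hB.three ha hb x)
      exact ⟨j :: i :: ρ, i :: j :: ρ, h1, h3, h2, h4, hA.three ha hb _⟩
    · obtain ⟨ρ, h1, h2, h3, h4, h5⟩ := four i j hi hj ha hb
      exact ⟨_, _, h1, h2, h3, h4, h5⟩
    · obtain ⟨ρ, h1, h2, h3, h4, h5⟩ := four j i hj hi hb ha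
      exact ⟨_, _, h2, h1, h4, h3, h5.symm⟩
    -- Both letters are descents of w, which contradicts α_i + α_j = 1.
    · have := hsum (w (basePt n))
      linarith

end

/-! ## Translations and diagram automorphisms -/

theorem ncard_sep_map_le {n : ℕ} {g : Aff n} (hg : PresRoots g) (x y : V n) :
    (sep (g x) (g y)).ncard ≤ (sep x y).ncard :=
  Set.ncard_le_ncard_of_injOn (fun φ => φ ∘ g) (fun φ hφ => ⟨hg φ hφ.1, hφ.2⟩)
    (fun φ _ ψ _ h => funext fun z => by
      simpa using congrFun h (g.symm z)) (sep_finite x y)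

section
variable {n : ℕ} [NeZero n]

/-- No affine root vanishes at the image of the base point under g, so a root separating the base
point from its image under gh changes sign either before or after that point. -/
theorem numInv_mul_le {g h : Aff n} (hg : PresRoots g) :
    numInv (g * h) ≤ numInv g + numInv h := by
  have hsub : sep (basePt n) ((g * h) (basePt n)) ⊆
      sep (basePt n) (g (basePt n)) ∪ sep (g (basePt n)) (g (h (basePt n))) := by
    rintro φ ⟨hφ, h1, h2⟩
    rcases lt_or_gt_of_ne (ne_zero_basePt (hg φ hφ)) with h3 | h3
    · exact Or.inl ⟨hφ, h1, h3⟩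
    · exact Or.inr ⟨hφ, h3, h2⟩
  refine (Set.ncard_le_ncard hsub ((sep_finite _ _).union (sep_finite _ _))).trans
    ((Set.ncard_union_le _ _).trans (Nat.add_le_add_left (ncard_sep_map_le hg _ _) _))

/-- The coweights are the vectors whose coordinates are all integers or all half-integers. -/
def IsCoweight {n : ℕ} (μ : V n) : Prop :=
  ∀ p q, ∃ a b : ℤ, μ p + μ q = a ∧ μ p - μ q = b

theorem transl_apply {n : ℕ} (μ x : V n) : transl μ x = μ + x := rfl

theorem IsCoweight.exists_shift {n : ℕ} {μ : V n} (hμ : IsCoweight μ) {φ : V n → ℚ}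
    (hφ : φ ∈ affRoots n) : ∃ z : ℤ, ∀ x, φ (μ + x) = φ x + z := by
  obtain ⟨p, q, e, e', k, he, he', -, rfl⟩ := hφ
  obtain ⟨a, b, ha, hb⟩ := hμ p q
  rcases he with rfl | rfl <;> rcases he' with rfl | rfl
  · exact ⟨a, fun x => by rw [← ha]; simp only [Pi.add_apply]; ring⟩
  · exact ⟨b, fun x => by rw [← hb]; simp only [Pi.add_apply]; ring⟩
  · exact ⟨-b, fun x => by push_cast; rw [← hb]; simp only [Pi.add_apply]; ring⟩
  · exact ⟨-a, fun x => by push_cast; rw [← ha]; simp only [Pi.add_apply]; ring⟩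

theorem add_int_mem_affRoots {n : ℕ} {φ : V n → ℚ} (hφ : φ ∈ affRoots n) (d : ℤ) :
    (fun x => φ x + d) ∈ affRoots n := by
  obtain ⟨p, q, e, e', k, he, he', hpq, rfl⟩ := hφ
  exact ⟨p, q, e, e', k + d, he, he', hpq, funext fun x => by push_cast; ring⟩

/-- The number of hyperplanes between a point and its translate is largest at the base point. -/
theorem ncard_sep_transl_le {μ : V n} (hμ : IsCoweight μ) (y : V n) :
    (sep y (μ + y)).ncard ≤ (sep (basePt n) (μ + basePt n)).ncard := by
  -- Each root is shifted by an integer so that its floor at the base point equals the original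
  -- floor at y. Translation by μ changes both values by the same integer, so the signs persist. The
  -- inequality at the base point stays strict because no affine root vanishes there.
  refine Set.ncard_le_ncard_of_injOn
    (fun φ x => φ x + ((⌊φ y⌋ - ⌊φ (basePt n)⌋ : ℤ) : ℚ)) ?_ ?_ (sep_finite _ _)
  · rintro φ ⟨hφ, h1, h2⟩
    have hψ := add_int_mem_affRoots hφ (⌊φ y⌋ - ⌊φ (basePt n)⌋)
    obtain ⟨z, hz⟩ := hμ.exists_shift hφ
    have hfl : ⌊φ (basePt n) + ((⌊φ y⌋ - ⌊φ (basePt n)⌋ : ℤ) : ℚ)⌋ = ⌊φ y⌋ := by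
      rw [Int.floor_add_intCast]; ring
    refine ⟨hψ, lt_of_le_of_ne ?_ (ne_zero_basePt hψ).symm, ?_⟩
    · rw [← Int.floor_nonneg, hfl, Int.floor_nonneg]
      exact h1.le
    · have h3 : ⌊φ y⌋ + z < 0 := by
        rw [← Int.floor_add_intCast, Int.floor_lt, ← hz]
        simpa using h2
      have h4 := Int.lt_floor_add_one (φ (basePt n) + ((⌊φ y⌋ - ⌊φ (basePt n)⌋ : ℤ) : ℚ))
      rw [hfl] at h4
      have h5 : (⌊φ y⌋ : ℚ) + z + 1 ≤ 0 := by exact_mod_cast (by omega : ⌊φ y⌋ + z + 1 ≤ 0)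
      dsimp only
      rw [hz]
      linarith
  · rintro φ - ψ - h
    have h' : ∀ x, φ x = ψ x +
        ((⌊ψ y⌋ - ⌊ψ (basePt n)⌋ - (⌊φ y⌋ - ⌊φ (basePt n)⌋) : ℤ) : ℚ) := fun x => by
      have := congrFun h x
      push_cast at this ⊢
      linarith
    -- Two roots with the same image differ by an integer c. The floors at y and at the base point
    -- both shift by c, which cancels and forces c = 0.
    generalize hc : ⌊ψ y⌋ - ⌊ψ (basePt n)⌋ - (⌊φ y⌋ - ⌊φ (basePt n)⌋) = c at h'
    rw [h' y, h' (basePt n), Int.floor_add_intCast, Int.floor_add_intCast] at hc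
    have hc0 : c = 0 := by omega
    funext x
    rw [h', hc0]
    simp

/-- Composition with u⁻¹ reduces the inversions of the conjugate to the roots separating the image
of the base point under u from its μ-translate. -/
theorem numInv_conj_transl_le {μ : V n} (hμ : IsCoweight μ) {u : Aff n} (hu : PresRoots u⁻¹) :
    numInv (u⁻¹ * (transl μ * u)) ≤ numInv (transl μ) := by
  have h := ncard_sep_map_le hu (u (basePt n)) (transl μ (u (basePt n)))
  have h0 : u⁻¹ (u (basePt n)) = basePt n := u.symm_apply_apply _
  rw [h0] at h
  exact h.trans (ncard_sep_transl_le hμ _)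

theorem IsCoweight.neg {n : ℕ} {μ : V n} (h : IsCoweight μ) : IsCoweight (-μ) := fun p q => by
  obtain ⟨a, b, ha, hb⟩ := h p q
  exact ⟨-a, -b, by push_cast; rw [← ha]; simp; ring, by push_cast; rw [← hb]; simp; ring⟩

theorem fundCoweight_apply {n : ℕ} {i : Fin n} (h : (i : ℕ) + 1 < n) (p : Fin n) :
    (fundCoweight i : V n) p = if p ≤ i then 1 else 0 := by
  rw [fundCoweight, if_pos h]
  simp [Finset.sum_apply, eps_apply]

theorem fundCoweight_apply_last {n : ℕ} {i : Fin n} (h : ¬ (i : ℕ) + 1 < n) (p : Fin n) :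
    (fundCoweight i : V n) p = 1 / 2 := by
  rw [fundCoweight, if_neg h]
  simp [Finset.sum_apply, eps_apply]

theorem isCoweight_fundCoweight {n : ℕ} (i : Fin n) : IsCoweight (fundCoweight i) := by
  intro p q
  by_cases h : (i : ℕ) + 1 < n
  · rw [fundCoweight_apply h, fundCoweight_apply h]
    exact ⟨(if p ≤ i then 1 else 0) + (if q ≤ i then 1 else 0),
      (if p ≤ i then 1 else 0) - (if q ≤ i then 1 else 0), by push_cast; rfl, by push_cast; rfl⟩
  · rw [fundCoweight_apply_last h, fundCoweight_apply_last h]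
    exact ⟨1, 0, by norm_num, by norm_num⟩

theorem lroot_fundCoweight (i k : Fin n) :
    lroot k.succ (fundCoweight i) = if k = i then (1 : ℚ) else 0 := by
  have hs := sroot_add k.succ (0 : V n) (fundCoweight i)
  have h0 : lroot k.succ (fundCoweight i) = sroot k.succ (fundCoweight i) := by
    simp [sroot, Fin.succ_ne_zero]
  rw [h0]
  by_cases hk : (k : ℕ) + 1 < n <;> by_cases hi : (i : ℕ) + 1 < n
  · rw [sroot_mid hk, fundCoweight_apply hi, fundCoweight_apply hi]
    simp only [Fin.le_def, Fin.ext_iff]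
    split_ifs <;> first | omega | norm_num
  · rw [sroot_mid hk, fundCoweight_apply_last hi, fundCoweight_apply_last hi,
      if_neg (by rintro rfl; exact hi hk)]
    ring
  · rw [sroot_last hk, fundCoweight_apply hi, if_neg (by rw [Fin.le_def]; omega),
      if_neg (by rintro rfl; exact hk hi)]
    ring
  · rw [sroot_last hk, fundCoweight_apply_last hi, if_pos (Fin.ext (by omega))]
    ring

theorem uN_apply {n : ℕ} (x : V n) (p : Fin n) : uN n x p = - x (Fin.rev p) := rfl

theorem uN_eps {n : ℕ} (p : Fin n) : uN n (eps p) = - eps (Fin.rev p) := by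
  funext q
  rw [uN_apply, Pi.neg_apply, eps_apply, eps_apply]
  congr 2
  rw [eq_iff_iff, Fin.rev_eq_iff]

/-- An involution in the extended affine Weyl group that fixes the base point, with its linear
part and its action on the affine nodes. -/
structure DiagramAut (n : ℕ) [NeZero n] where
  toAff : Aff n
  lin : V n ≃ₗ[ℚ] V n
  node : Fin (n + 1) → Fin (n + 1)
  map_add : ∀ x v, toAff (x + v) = toAff x + lin v
  mul_self : toAff * toAff = 1
  sroot_apply : ∀ j x, sroot j (toAff x) = sroot (node j) x
  lin_scoroot : ∀ j, lin (scoroot (node j)) = scoroot j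
  map_basePt : toAff (basePt n) = basePt n
  presRoots : PresRoots toAff

namespace DiagramAut
variable (D : DiagramAut n)

theorem inv_eq : D.toAff⁻¹ = D.toAff := inv_eq_of_mul_eq_one_left D.mul_self

theorem lroot_lin (j : Fin (n + 1)) (v : V n) : lroot j (D.lin v) = lroot (D.node j) v := by
  have h1 := D.sroot_apply j (0 + v)
  rw [D.map_add, sroot_add, sroot_add, D.sroot_apply] at h1
  linarith

theorem simpleRefl_mul (j : Fin (n + 1)) :
    simpleRefl j * D.toAff = D.toAff * simpleRefl (D.node j) := by
  ext1 x
  rw [mul_apply_aff, mul_apply_aff, simpleRefl_apply, simpleRefl_apply, D.sroot_apply,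
    sub_eq_add_neg x, D.map_add, map_neg, map_smul, D.lin_scoroot, sub_eq_add_neg]

theorem conj_wordProd (ω : List (Fin (n + 1))) :
    D.toAff⁻¹ * wordProd ω * D.toAff = wordProd (ω.map D.node) := by
  induction ω with
  | nil => simp [wordProd]
  | cons j ω ih =>
    rw [List.map_cons, wordProd_cons, wordProd_cons, ← ih, mul_assoc, mul_assoc, mul_assoc,
      ← mul_assoc _ D.toAff⁻¹, inv_mul_eq_iff_eq_mul, ← mul_assoc D.toAff, ← mul_assoc D.toAff,
      ← D.simpleRefl_mul]
    group

theorem conj_mem {v : Aff n} (hv : v ∈ Waf n) : D.toAff⁻¹ * v * D.toAff ∈ Waf n := by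
  obtain ⟨ω, rfl⟩ := exists_word hv
  rw [D.conj_wordProd]
  exact wordProd_mem _

theorem numInv_mul_right (g : Aff n) : numInv (g * D.toAff) = numInv g := by
  rw [numInv, numInv, mul_apply_aff, D.map_basePt]

/-- The automorphism fixes the base point and preserves the affine roots, which bounds the count in
one direction. The reverse bound holds because it is an involution. -/
theorem numInv_mul_left (g : Aff n) : numInv (D.toAff * g) = numInv g := by
  have h : ∀ g : Aff n, numInv (D.toAff * g) ≤ numInv g := fun g => by
    have := ncard_sep_map_le D.presRoots (basePt n) (g (basePt n))
    rwa [D.map_basePt] at this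
  refine le_antisymm (h g) ?_
  have := h (D.toAff * g)
  rwa [← mul_assoc, D.mul_self, one_mul] at this

theorem len_conj {v : Aff n} (hv : v ∈ Waf n) : len (D.toAff⁻¹ * v * D.toAff) = len v := by
  rw [len_eq_numInv hv, len_eq_numInv (D.conj_mem hv), D.numInv_mul_right, D.inv_eq,
    D.numInv_mul_left]

/-- The trivial diagram automorphism. -/
def trivial (n : ℕ) [NeZero n] : DiagramAut n where
  toAff := 1
  lin := LinearEquiv.refl ℚ _
  node := id
  map_add _ _ := rfl
  mul_self := one_mul 1
  sroot_apply _ _ := rfl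
  lin_scoroot _ := rfl
  map_basePt := rfl
  presRoots _ h := h

theorem piN_apply (x : V n) (p : Fin n) : piN n x p = 1 / 2 - x (Fin.rev p) := by
  have h : ¬ ((lastNode n : Fin n) : ℕ) + 1 < n := by
    have := NeZero.pos n
    simp [lastNode, Fin.val_rev]; omega
  change fundCoweight (lastNode n) p + uN n x p = _
  rw [fundCoweight_apply_last h, uN_apply]
  ring

/-- The diagram automorphism of the length-zero element `π_n`. -/
def ofPiN (n : ℕ) [NeZero n] : DiagramAut n where
  toAff := piN n
  lin := uN n
  node := Fin.rev
  map_add x v := by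
    funext p
    rw [piN_apply, Pi.add_apply, Pi.add_apply, piN_apply, uN_apply]
    ring
  mul_self := by
    ext x p
    rw [mul_apply_aff, piN_apply, piN_apply, Fin.rev_rev]
    simp
  sroot_apply j x := by
    have hn := NeZero.pos n
    refine Fin.cases ?_ (fun j => ?_) j
    · rw [show Fin.rev (0 : Fin (n + 1)) = (Fin.rev (0 : Fin n)).succ by
          apply Fin.ext; simp [Fin.val_rev]; omega,
        sroot_zero, sroot_last (by simp [Fin.val_rev]; omega), piN_apply]
      ring
    · have hj := j.2
      by_cases h : (j : ℕ) + 1 < n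
      · have hr : ((Fin.rev ⟨j + 1, h⟩ : Fin n) : ℕ) + 1 < n := by
          simp only [Fin.val_rev]; omega
        rw [show Fin.rev j.succ = (Fin.rev (⟨j + 1, h⟩ : Fin n)).succ by
            apply Fin.ext; simp [Fin.val_rev]; omega,
          sroot_mid h, sroot_mid hr, piN_apply, piN_apply,
          show (⟨(Fin.rev ⟨j + 1, h⟩ : Fin n) + 1, hr⟩ : Fin n) = Fin.rev j by
            apply Fin.ext; simp only [Fin.val_rev]; omega]
        ring
      · rw [show Fin.rev j.succ = 0 by apply Fin.ext; simp [Fin.val_rev]; omega,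
          sroot_last h, sroot_zero, piN_apply,
          show Fin.rev j = 0 by apply Fin.ext; rw [Fin.val_zero, Fin.val_rev]; omega]
        ring
  lin_scoroot j := by
    have hn := NeZero.pos n
    refine Fin.cases ?_ (fun j => ?_) j
    · rw [show Fin.rev (0 : Fin (n + 1)) = (Fin.rev (0 : Fin n)).succ by
          apply Fin.ext; simp [Fin.val_rev]; omega,
        scoroot_zero, scoroot_succ, simpleCoroot, dif_neg (by simp [Fin.val_rev]; omega), uN_eps,
        Fin.rev_rev]
    · have hj := j.2
      by_cases h : (j : ℕ) + 1 < n
      · have hr : ((Fin.rev ⟨j + 1, h⟩ : Fin n) : ℕ) + 1 < n := by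
          simp only [Fin.val_rev]; omega
        rw [show Fin.rev j.succ = (Fin.rev (⟨j + 1, h⟩ : Fin n)).succ by
            apply Fin.ext; simp [Fin.val_rev]; omega,
          scoroot_succ, scoroot_succ, simpleCoroot, simpleCoroot, dif_pos h, dif_pos hr, map_sub,
          uN_eps, uN_eps, Fin.rev_rev,
          show (⟨(Fin.rev ⟨j + 1, h⟩ : Fin n) + 1, hr⟩ : Fin n) = Fin.rev j by
            apply Fin.ext; simp only [Fin.val_rev]; omega, Fin.rev_rev]
        abel
      · rw [show Fin.rev j.succ = 0 by apply Fin.ext; simp [Fin.val_rev]; omega,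
          scoroot_zero, scoroot_succ, simpleCoroot, dif_neg h, map_neg, uN_eps,
          show j = Fin.rev 0 by apply Fin.ext; rw [Fin.val_rev, Fin.val_zero]; omega, neg_neg]
  map_basePt := by
    funext p
    have hn := natCast_pos' (n := n)
    rw [piN_apply]
    simp only [basePt, Fin.val_rev]
    rw [Nat.cast_sub (by have := p.2; omega)]
    push_cast
    field_simp
    ring
  presRoots := presRoots_of_signedPerm Fin.revPerm (fun _ => -1) (fun _ => 1 / 2)
    (fun _ => Or.inr rfl) (fun _ _ => ⟨1, 0, by norm_num, by norm_num⟩) fun x p => by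
      rw [piN_apply, Fin.revPerm_apply]; ring

/-- The minimality of `v κ` in its coset passes to the conjugate of `v`. -/
theorem conj_mem_Waf0 {v : Aff n} (hv : v ∈ Waf n) {μ : V n} (hμ : IsCoweight μ)
    (hvκ : v * (D.toAff * transl μ) ∈ Waf0 n)
    (hlen : len (v * (D.toAff * transl μ)) = len v + len (D.toAff * transl μ)) :
    D.toAff⁻¹ * v * D.toAff ∈ Waf0 n := by
  refine ⟨D.conj_mem hv, fun u hu => ?_⟩
  have hu' : u ∈ Waf n := Subgroup.closure_mono (by rintro _ ⟨i, rfl⟩; exact ⟨_, rfl⟩) hu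
  have hκ : D.toAff * transl μ ∈ Waf n := ((Waf n).mul_mem_cancel_left hv).1 hvκ.1
  have hv' := D.conj_mem hv
  have h1 := hvκ.2 u hu
  rw [hlen, ← D.len_conj hv, len_eq_numInv hκ, D.numInv_mul_left,
    len_eq_numInv ((Waf n).mul_mem hvκ.1 hu')] at h1
  -- Moving the translation to the far right conjugates it by u. Subadditivity and the bound on the
  -- conjugate then cancel the length of κ.
  have h2 : v * (D.toAff * transl μ) * u =
      D.toAff * ((D.toAff⁻¹ * v * D.toAff * u) * (u⁻¹ * (transl μ * u))) := by group
  rw [h2, D.numInv_mul_left] at h1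
  have h3 := numInv_mul_le (h := u⁻¹ * (transl μ * u))
    (presRoots_of_mem ((Waf n).mul_mem hv' hu'))
  have h4 := numInv_conj_transl_le hμ (presRoots_of_mem ((Waf n).inv_mem hu'))
  rw [len_eq_numInv ((Waf n).mul_mem hv' hu')]
  omega

end DiagramAut

end

/-! ## The level zero action -/

/-- The assignment f ↦ ∏_j f(y_j) is multiplicative. With constant terms 1, variables outside the
support of m contribute nothing, so the claim is distributivity of a finite product over sums. -/
theorem coeff_prod_mul_coeff_prod {R : Type*} [CommRing R] {f g : PowerSeries R}
    (hf : PowerSeries.coeff 0 f = 1) (hg : PowerSeries.coeff 0 g = 1) (m : ℕ →₀ ℕ) :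
    ∑ p ∈ Finset.HasAntidiagonal.antidiagonal m, (p.1.prod fun _ k => PowerSeries.coeff k f) *
        (p.2.prod fun _ k => PowerSeries.coeff k g) =
      m.prod fun _ k => PowerSeries.coeff k (f * g) := by
  have h1 : ∀ p ∈ Finset.HasAntidiagonal.antidiagonal m,
      (p.1.prod fun _ k => PowerSeries.coeff k f) *
        (p.2.prod fun _ k => PowerSeries.coeff k g) =
      ∏ j ∈ m.support, PowerSeries.coeff (p.1 j) f * PowerSeries.coeff (p.2 j) g := by
    rintro ⟨a, b⟩ hab
    rw [Finset.HasAntidiagonal.mem_antidiagonal] at hab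
    subst hab
    rw [Finset.prod_mul_distrib]
    congr 1
    · refine Finsupp.prod_of_support_subset _ ?_ _ (fun _ _ => hf)
      intro j hj
      simp only [Finsupp.mem_support_iff, Finsupp.add_apply] at hj ⊢
      omega
    · refine Finsupp.prod_of_support_subset _ ?_ _ (fun _ _ => hg)
      intro j hj
      simp only [Finsupp.mem_support_iff, Finsupp.add_apply] at hj ⊢
      omega
  rw [Finset.sum_congr rfl h1, Finsupp.prod]
  simp only [PowerSeries.coeff_mul]
  rw [Finset.prod_sum]
  refine Finset.sum_bij (fun p _ j _ => (p.1 j, p.2 j)) ?_ ?_ ?_ ?_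
  · rintro ⟨a, b⟩ hab
    rw [Finset.HasAntidiagonal.mem_antidiagonal] at hab
    rw [Finset.mem_pi]
    intro j _
    rw [Finset.HasAntidiagonal.mem_antidiagonal, ← hab]
    rfl
  · rintro ⟨a, b⟩ hab ⟨a', b'⟩ hab' h
    rw [Finset.HasAntidiagonal.mem_antidiagonal] at hab hab'
    have hj : ∀ j, a j = a' j ∧ b j = b' j := by
      intro j
      by_cases hj : j ∈ m.support
      · have := congrFun (congrFun h j) hj
        simpa using this
      · rw [Finsupp.notMem_support_iff] at hj
        have e1 := DFunLike.congr_fun hab j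
        have e2 := DFunLike.congr_fun hab' j
        simp only [Finsupp.add_apply, hj] at e1 e2
        omega
    exact Prod.ext (Finsupp.ext fun j => (hj j).1) (Finsupp.ext fun j => (hj j).2)
  · intro p hp
    rw [Finset.mem_pi] at hp
    refine ⟨(Finsupp.onFinset m.support (fun j => if h : j ∈ m.support then (p j h).1 else 0) ?_,
      Finsupp.onFinset m.support (fun j => if h : j ∈ m.support then (p j h).2 else 0) ?_), ?_, ?_⟩
    · intro j hj
      by_contra h
      exact hj (dif_neg h)
    · intro j hj
      by_contra h
      exact hj (dif_neg h)
    · rw [Finset.HasAntidiagonal.mem_antidiagonal]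
      ext j
      by_cases h : j ∈ m.support
      · have := Finset.HasAntidiagonal.mem_antidiagonal.1 (hp j h)
        simpa only [Finsupp.add_apply, Finsupp.onFinset_apply, dif_pos h] using this
      · simpa only [Finsupp.add_apply, Finsupp.onFinset_apply, dif_neg h, add_zero] using
          (Finsupp.notMem_support_iff.1 h).symm
    · funext j hj
      simp only [Finsupp.onFinset_apply, dif_pos hj]
  · rintro ⟨a, b⟩ _
    exact (Finset.prod_attach m.support
      fun j => PowerSeries.coeff (a j) f * PowerSeries.coeff (b j) g).symm

/-- Replacing u by -u exchanges numerator and denominator. Over a domain their product can be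
cancelled, since its constant term is 1. -/
theorem omegaOne_mul_neg {R : Type*} [CommRing R] [IsDomain R] (u : R) :
    omegaOne u * omegaOne (-u) = 1 := by
  have h1 := omegaOne_spec u
  have h2 := omegaOne_spec (-u)
  rw [map_neg] at h2
  have h3 : ((1 - PowerSeries.C u * PowerSeries.X) * (1 + PowerSeries.C u * PowerSeries.X) :
      PowerSeries R) ≠ 0 := by
    intro h
    have := congrArg PowerSeries.constantCoeff h
    simp at this
  apply mul_right_cancel₀ h3
  linear_combination (omegaOne (-u) * (1 + PowerSeries.C u * PowerSeries.X)) * h1 +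
    (1 + PowerSeries.C u * PowerSeries.X) * h2

section
variable {n : ℕ}

theorem Om_mul_neg (u : S n) : Om u * Om (-u) = 1 := by
  apply Subtype.ext
  change omegaSeries u * omegaSeries (-u) = 1
  ext1 m
  rw [MvPowerSeries.coeff_mul]
  simp only [coeff_omegaSeries]
  rw [coeff_prod_mul_coeff_prod (coeff_zero_omegaOne u) (coeff_zero_omegaOne (-u)),
    omegaOne_mul_neg, MvPowerSeries.coeff_one]
  split_ifs with hm
  · subst hm; simp
  · obtain ⟨j, hj⟩ := Finsupp.support_nonempty_iff.2 hm
    refine Finset.prod_eq_zero hj ?_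
    dsimp only
    rw [PowerSeries.coeff_one, if_neg (Finsupp.mem_support_iff.1 hj)]

theorem mapCoeff_mul (φ : S n →ₐ[ℂ] S n) (f g : hatLam n) :
    mapCoeff φ (f * g) = mapCoeff φ f * mapCoeff φ g :=
  Subtype.ext (map_mul (MvPowerSeries.map φ.toRingHom) f.1 g.1)

theorem mapCoeff_sub (φ : S n →ₐ[ℂ] S n) (f g : hatLam n) :
    mapCoeff φ (f - g) = mapCoeff φ f - mapCoeff φ g :=
  Subtype.ext (map_sub (MvPowerSeries.map φ.toRingHom) f.1 g.1)

theorem mapCoeff_one (φ : S n →ₐ[ℂ] S n) : mapCoeff φ (1 : hatLam n) = 1 :=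
  Subtype.ext (map_one (MvPowerSeries.map φ.toRingHom))

theorem mapCoeff_smul (φ : S n →ₐ[ℂ] S n) (r : S n) (f : hatLam n) :
    mapCoeff φ (r • f) = φ r • mapCoeff φ f := by
  apply Subtype.ext
  ext1 m
  exact map_mul φ r (MvPowerSeries.coeff m f.1)

theorem mapCoeff_mapCoeff (φ ψ : S n →ₐ[ℂ] S n) (f : hatLam n) :
    mapCoeff φ (mapCoeff ψ f) = mapCoeff (φ.comp ψ) f := rfl

theorem mapCoeff_Om (φ : S n →ₐ[ℂ] S n) (u : S n) : mapCoeff φ (Om u) = Om (φ u) := by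
  apply Subtype.ext
  ext1 m
  change φ (MvPowerSeries.coeff m (omegaSeries u)) = MvPowerSeries.coeff m (omegaSeries (φ u))
  rw [coeff_omegaSeries, coeff_omegaSeries, Finsupp.prod, Finsupp.prod, map_prod]
  refine Finset.prod_congr rfl fun j _ => ?_
  have : PowerSeries.map φ.toRingHom (omegaOne u) = omegaOne (φ u) := by
    rw [omegaOne, omegaOne, map_mul, map_add, map_mul, map_one, PowerSeries.map_C,
      PowerSeries.map_X]
    congr 1
    ext k
    simp
  rw [← this, PowerSeries.coeff_map]
  rfl

theorem linAct_formToS (g : V n ≃ₗ[ℚ] V n) (f : Module.Dual ℚ (V n)) :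
    linAct g (formToS f) = formToS (f ∘ₗ (g.symm : V n →ₗ[ℚ] V n)) := by
  have hf : f = ∑ i, f (eps i) • wt i := by
    refine LinearMap.pi_ext' fun j => ?_
    ext1
    simp [wt, eps, Pi.single_apply]
  have hlin : ∀ c : Fin n → ℚ, ∀ w : Fin n → Module.Dual ℚ (V n),
      formToS (∑ i, c i • w i) = ∑ i, MvPolynomial.C ((c i : ℚ) : ℂ) * formToS (w i) := by
    intro c w
    simp only [formToS, LinearMap.sum_apply, LinearMap.smul_apply, smul_eq_mul, Rat.cast_sum,
      Rat.cast_mul, map_sum, map_mul, Finset.sum_mul, Finset.mul_sum, mul_assoc]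
    exact Finset.sum_comm
  have h1 : f ∘ₗ (g.symm : V n →ₗ[ℚ] V n) =
      ∑ i, f (eps i) • (wt i ∘ₗ (g.symm : V n →ₗ[ℚ] V n)) := by
    conv_lhs => rw [hf]
    ext1 j
    ext1
    simp
  rw [h1, hlin, formToS, map_sum]
  refine Finset.sum_congr rfl fun i _ => ?_
  rw [map_mul, linAct, MvPolynomial.aeval_X]
  congr 1
  exact MvPolynomial.algHom_C _ _

theorem linAct_comp (g h : V n ≃ₗ[ℚ] V n) : (linAct g).comp (linAct h) = linAct (h.trans g) := by
  ext1 i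
  rw [AlgHom.comp_apply, ← formToS_wt, linAct_formToS, linAct_formToS, linAct_formToS]
  rfl

theorem linAct_X (g : V n ≃ₗ[ℚ] V n) (i : Fin n) :
    linAct g (MvPolynomial.X i) = formToS (wt i ∘ₗ (g.symm : V n →ₗ[ℚ] V n)) := by
  rw [linAct, MvPolynomial.aeval_X]

theorem mapCoeff_linAct (g h : V n ≃ₗ[ℚ] V n) (f : hatLam n) :
    mapCoeff (linAct g) (mapCoeff (linAct h) f) = mapCoeff (linAct (h.trans g)) f := by
  rw [mapCoeff_mapCoeff, linAct_comp]

theorem smul_hatLam_cancel {r : S n} (hr : r ≠ 0) {f g : hatLam n} (h : r • f = r • g) :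
    f = g := by
  apply Subtype.ext
  ext1 m
  exact mul_left_cancel₀ hr (congrArg (fun f : hatLam n => MvPowerSeries.coeff m f.1) h)

end

/-! ### The simple reflections acting on symmetric functions -/

section
variable {n : ℕ} [NeZero n]

/-- The linear parts of the simple reflections. -/
def lrefl (i : Fin (n + 1)) : V n ≃ₗ[ℚ] V n := Module.reflection (lroot_scoroot_self i)

theorem lrefl_apply (i : Fin (n + 1)) (x : V n) : lrefl i x = x - lroot i x • scoroot i :=
  Module.reflection_apply _ _

theorem lrefl_symm (i : Fin (n + 1)) : (lrefl i : V n ≃ₗ[ℚ] V n).symm = lrefl i :=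
  Module.reflection_symm _

theorem lrefl_zero : (lrefl 0 : V n ≃ₗ[ℚ] V n) = Module.reflection (theta_thetaCoroot n) := by
  ext1 x
  rw [lrefl_apply, Module.reflection_apply, lroot_zero, scoroot_zero, thetaCoroot]
  simp

/-- The action of the linear part of `s_i` on the coefficients. -/
def coeffRefl (i : Fin (n + 1)) (f : hatLam n) : hatLam n := mapCoeff (linAct (lrefl i)) f

/-- The translation part of `s_i`. -/
def om : Fin (n + 1) → hatLam n := Fin.cases (Om (MvPolynomial.X 0)) fun _ => 1

theorem om_zero : (om 0 : hatLam n) = Om (MvPolynomial.X 0) := rfl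

theorem om_of_ne_zero {i : Fin (n + 1)} (h : i ≠ 0) : (om i : hatLam n) = 1 := by
  obtain ⟨i, rfl⟩ := Fin.exists_succ_eq.2 h
  rfl

theorem reflAct_eq (i : Fin (n + 1)) (f : hatLam n) : reflAct i f = om i * coeffRefl i f := by
  refine Fin.cases ?_ (fun i => ?_) i
  · rw [coeffRefl, lrefl_zero]
    rfl
  · rw [om_of_ne_zero (Fin.succ_ne_zero i), one_mul]
    rfl

theorem coeffRefl_mul (i : Fin (n + 1)) (f g : hatLam n) :
    coeffRefl i (f * g) = coeffRefl i f * coeffRefl i g := mapCoeff_mul _ _ _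

theorem linAct_lrefl_formToS (i : Fin (n + 1)) (f : Module.Dual ℚ (V n)) :
    linAct (lrefl i) (formToS f) = formToS (f - f (scoroot i) • lroot i) := by
  rw [linAct_formToS, lrefl_symm]
  congr 1
  ext1 j
  ext1
  simp [lrefl_apply, mul_comm]

theorem coeffRefl_Om (i : Fin (n + 1)) (f : Module.Dual ℚ (V n)) :
    coeffRefl i (Om (formToS f)) = Om (formToS (f - f (scoroot i) • lroot i)) := by
  rw [coeffRefl, mapCoeff_Om, linAct_lrefl_formToS]

theorem rootS_eq (i : Fin (n + 1)) : (rootS i : S n) = formToS (lroot i) := by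
  refine Fin.cases rfl (fun i => rfl) i

theorem linAct_lrefl_rootS (i j : Fin (n + 1)) : (linAct (lrefl i) (rootS j) : S n) =
    rootS j - MvPolynomial.C ((lroot j (scoroot i) : ℚ) : ℂ) * rootS i := by
  rw [rootS_eq, rootS_eq, linAct_lrefl_formToS, formToS_sub_smul]

theorem braidRels_lrefl : BraidRels fun (i : Fin (n + 1)) (x : V n) => lrefl i x :=
  braidRels_of_reflection (α := fun i x => lroot i x) lrefl_apply fun i j x => by
    rw [lrefl_apply, map_sub, map_smul, smul_eq_mul]; ring

theorem braidRels_coeffRefl : BraidRels (coeffRefl : Fin (n + 1) → hatLam n → hatLam n) where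
  two h h' f := by
    simp only [coeffRefl, mapCoeff_linAct]
    congr 2
    ext1 x
    exact braidRels_lrefl.two h h' x
  three h h' f := by
    simp only [coeffRefl, mapCoeff_linAct]
    congr 2
    ext1 x
    exact braidRels_lrefl.three h h' x
  four h h' f := by
    simp only [coeffRefl, mapCoeff_linAct]
    congr 2
    ext1 x
    exact (braidRels_lrefl.four h h' x)

theorem coeffRefl_coeffRefl (i : Fin (n + 1)) (f : hatLam n) :
    coeffRefl i (coeffRefl i f) = f := by
  simp only [coeffRefl, mapCoeff_linAct]
  have : (lrefl i : V n ≃ₗ[ℚ] V n).trans (lrefl i) = LinearEquiv.refl ℚ _ := by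
    ext1 x
    exact Module.involutive_reflection (lroot_scoroot_self i) x
  rw [this]
  apply Subtype.ext
  ext1 m
  have h : linAct (LinearEquiv.refl ℚ (V n)) = AlgHom.id ℂ (S n) := by
    ext1 j
    rw [linAct_X, AlgHom.id_apply, ← formToS_wt]
    rfl
  rw [h]
  rfl

theorem lroot_zero_scoroot (j : Fin (n + 1)) :
    lroot 0 (scoroot j) = -2 * (scoroot j : V n) 0 := by
  rw [lroot_zero]; simp [theta, wt]

/-- The root θ = 2a_1 takes even values on coroots. Hence the node 0 occurs in no relation of length
three, and only as the first index of one of length four. -/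
theorem lroot_zero_scoroot_ne (j : Fin (n + 1)) : lroot 0 (scoroot j : V n) ≠ -1 := by
  rw [lroot_zero_scoroot]
  refine Fin.cases ?_ (fun j => ?_) j
  · rw [scoroot_zero, Pi.neg_apply, eps_apply]
    norm_num
  · rw [scoroot_succ, simpleCoroot]
    split_ifs
    · rw [Pi.sub_apply, eps_apply, eps_apply]
      split_ifs <;> norm_num
    · rw [eps_apply]
      split_ifs <;> norm_num

theorem coeffRefl_om_zero (j : Fin (n + 1)) : coeffRefl j (om 0 : hatLam n) =
    Om (formToS (wt 0 - (scoroot j : V n) 0 • lroot j)) := by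
  rw [om_zero, ← formToS_wt, coeffRefl_Om]
  rfl

/-- The coefficient actions already satisfy the relations. What remains is to compare the factors Ω
that the two words collect from their letters s_0. -/
theorem braidRels_reflAct : BraidRels (reflAct : Fin (n + 1) → hatLam n → hatLam n) where
  two := by
    have key : ∀ j : Fin (n + 1), lroot 0 (scoroot j : V n) = 0 → lroot j (scoroot 0 : V n) = 0 →
        ∀ f : hatLam n, reflAct 0 (reflAct j f) = reflAct j (reflAct 0 f) := by
      intro j h h' f
      have hj : j ≠ 0 := by
        rintro rfl
        rw [lroot_scoroot_self] at h
        norm_num at h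
      have hc : (scoroot j : V n) 0 = 0 := by
        rw [lroot_zero_scoroot] at h
        linarith
      simp only [reflAct_eq, coeffRefl_mul, om_of_ne_zero hj, one_mul]
      rw [coeffRefl_om_zero, hc, zero_smul, sub_zero, formToS_wt, ← om_zero,
        braidRels_coeffRefl.two h' h f]
    intro i j h h' f
    by_cases hi : i = 0
    · subst hi
      exact key j h' h f
    by_cases hj : j = 0
    · subst hj
      exact (key i h h' f).symm
    simp only [reflAct_eq, om_of_ne_zero hi, om_of_ne_zero hj, one_mul]
    exact braidRels_coeffRefl.two h h' f
  three {i j} h h' f := by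
    have hi : i ≠ 0 := by rintro rfl; exact lroot_zero_scoroot_ne _ h'
    have hj : j ≠ 0 := by rintro rfl; exact lroot_zero_scoroot_ne _ h
    simp only [reflAct_eq, om_of_ne_zero hi, om_of_ne_zero hj, one_mul]
    exact braidRels_coeffRefl.three h h' f
  four {i j} h h' f := by
    have hj : j ≠ 0 := by rintro rfl; exact lroot_zero_scoroot_ne _ h
    by_cases hi : i = 0
    · subst hi
      have hc : (scoroot j : V n) 0 = 1 := by
        rw [lroot_zero_scoroot] at h'
        linarith
      have hw : wt 0 (scoroot 0 : V n) = -1 := by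
        rw [scoroot_zero, map_neg]; simp [wt, eps]
      have hw' : wt 0 (scoroot j : V n) = 1 := hc
      -- The reflection s_j exchanges Ω(a_1) with Ω(a_1 - α_j), and s_θ fixes the latter. Both words
      -- therefore collect the product of these two factors.
      have h1 : coeffRefl j (om 0 : hatLam n) = Om (formToS (wt 0 - lroot j)) := by
        rw [coeffRefl_om_zero, hc, one_smul]
      have h2 : coeffRefl 0 (Om (formToS (wt 0 - lroot j)) : hatLam n) =
          Om (formToS (wt 0 - lroot j)) := by
        rw [coeffRefl_Om, LinearMap.sub_apply, hw, h]
        simp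
      have h3 : coeffRefl j (Om (formToS (wt 0 - lroot j)) : hatLam n) = om 0 := by
        rw [coeffRefl_Om, LinearMap.sub_apply, hw', lroot_scoroot_self, om_zero, ← formToS_wt]
        congr 2
        module
      simp only [reflAct_eq, coeffRefl_mul, om_of_ne_zero hj, one_mul, h1, h2, h3]
      rw [braidRels_coeffRefl.four h h' f]
      ring
    · simp only [reflAct_eq, om_of_ne_zero hi, om_of_ne_zero hj, one_mul]
      exact braidRels_coeffRefl.four h h' f

end

/-! ## Braid relations of the divided difference operators -/

section
variable {R M : Type*} [CommRing R] [AddCommGroup M] [Module R M] {A B s t : M → M} {σ τ : R → R}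
  {α β γ δ a b : R}

/-- Cleared of denominators, an alternating product of A and B becomes the signed sum over the
dihedral group generated by s and t. These formulas transfer the braid relation from s, t to A, B.
-/
theorem divDiff_formula_two (hA : ∀ f, α • A f = f - s f) (hB : ∀ f, β • B f = f - t f)
    (hs : ∀ f g, s (f - g) = s f - s g) (hsm : ∀ (r : R) f, s (r • f) = σ r • s f)
    (hβ : σ β = β) (f : M) : (α * β) • A (B f) = f - s f - t f + s (t f) := by
  have e1 := hA (B f)
  have e2 := hB f
  have e3 := congrArg s e2
  rw [hsm, hs, hβ] at e3
  linear_combination (norm := module) β • e1 + e2 - e3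

theorem divDiff_formula_three (hA : ∀ f, α • A f = f - s f) (hB : ∀ f, β • B f = f - t f)
    (hsA : ∀ f, s (A f) = A f)
    (hs : ∀ f g, s (f - g) = s f - s g) (hsm : ∀ (r : R) f, s (r • f) = σ r • s f)
    (ht : ∀ f g, t (f - g) = t f - t g) (htm : ∀ (r : R) f, t (r • f) = τ r • t f)
    (hγ : γ = α + β) (hβ : σ β = γ) (hα : τ α = γ) (hσγ : σ γ = β) (f : M) :
    (α * β * γ) • A (B (A f)) = f - s f - t f + t (s f) + s (t f) - s (t (s f)) := by
  have e1 := hA f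
  have e2 := hB (A f)
  have e3 := hA (B (A f))
  have e4 := congrArg s e2
  rw [hsm, hs, hβ, hsA] at e4
  have e5 := congrArg t e1
  rw [htm, ht, hα] at e5
  have e6 := congrArg s e5
  rw [hsm, hs, hσγ] at e6
  subst hγ
  linear_combination (norm := module) (β * (α + β)) • e3 + (α + β) • e2 - β • e4 + e1 - e5 + e6

/-- Only the product ab = 2 is prescribed, so that the formula applies to the long and short root in
either order. The common factor β is an artefact of the elimination and is cancelled by the user. -/
theorem divDiff_formula_four (hA : ∀ f, α • A f = f - s f) (hB : ∀ f, β • B f = f - t f)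
    (hsA : ∀ f, s (A f) = A f) (htB : ∀ f, t (B f) = B f)
    (hs : ∀ f g, s (f - g) = s f - s g) (hsm : ∀ (r : R) f, s (r • f) = σ r • s f)
    (ht : ∀ f g, t (f - g) = t f - t g) (htm : ∀ (r : R) f, t (r • f) = τ r • t f)
    (hab : a * b = 2) (hγ : γ = β + a * α) (hδ : δ = α + b * β)
    (hβ : σ β = γ) (hα : τ α = δ) (hσδ : σ δ = δ) (hτγ : τ γ = γ) (hτδ : τ δ = α) (f : M) :
    β • (α * β * γ * δ) • B (A (B (A f))) = β • (f - s f - t f + t (s f) + s (t f) - s (t (s f))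
      - t (s (t f)) + t (s (t (s f)))) := by
  have e1 := hA f
  have e2 := hB (A f)
  have e3 := hA (B (A f))
  have e4 := hB (A (B (A f)))
  have e5 := congrArg s e2
  rw [hsm, hs, hβ, hsA] at e5
  have e6 := congrArg t e3
  rw [htm, ht, hα, htB] at e6
  have e7 := congrArg t e5
  rw [htm, ht, hτγ] at e7
  have e8 := congrArg t e1
  rw [htm, ht, hα] at e8
  have e9 := congrArg s e8
  rw [hsm, hs, hσδ] at e9
  have e10 := congrArg t e9
  rw [htm, ht, hτδ] at e10
  -- This is the coefficient of A f, and the next identity is that of t (A f), left over by the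
  -- elimination. Both are divisible by β, the origin of the common factor.
  have c1 : γ * δ - β * δ - α * γ = α * β := by
    subst hγ hδ
    linear_combination (α * β) * hab
  have c2 : α * γ + α * β - γ * δ = - (β * δ) := by
    linear_combination -c1
  linear_combination (norm := module) (α * β * γ * δ) • e4 + (β * γ * δ) • e3 + (γ * δ) • e2
    - (β * δ) • e5 - (α * β * γ) • e6 - (α * γ) • e2 + (α * β) • e7 + β • e1 - β • e8 + β • e9
    - β • e10 + c1 • A f + c2 • t (A f)

end

theorem formToS_neg_wt {n : ℕ} (p : Fin n) : formToS (-wt p) = -(MvPolynomial.X p : S n) := by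
  have := formToS_sub_smul (0 : Module.Dual ℚ (V n)) (wt p) 1
  rw [one_smul, zero_sub] at this
  rw [this, formToS_wt]
  simp [formToS]

/-! ### Divided differences for the affine nodes -/

section
variable {n : ℕ} [NeZero n]

theorem divDiff_spec (i : Fin (n + 1)) (f : hatLam n) :
    rootS i • divDiff i f = f - reflAct i f :=
  (existsUnique_divDiff i f).choose_spec.1

theorem reflAct_sub (i : Fin (n + 1)) (f g : hatLam n) :
    reflAct i (f - g) = reflAct i f - reflAct i g := by
  simp only [reflAct_eq, coeffRefl, mapCoeff_sub]
  ring

theorem reflAct_smul (i : Fin (n + 1)) (r : S n) (f : hatLam n) :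
    reflAct i (r • f) = linAct (lrefl i) r • reflAct i f := by
  rw [reflAct_eq, coeffRefl, mapCoeff_smul, mul_smul_comm, reflAct_eq, coeffRefl]

theorem reflAct_reflAct (i : Fin (n + 1)) (f : hatLam n) : reflAct i (reflAct i f) = f := by
  rw [reflAct_eq, reflAct_eq, coeffRefl_mul, coeffRefl_coeffRefl, ← mul_assoc]
  suffices h : (om i * coeffRefl i (om i) : hatLam n) = 1 by rw [h, one_mul]
  by_cases hi : i = 0
  · subst hi
    have h : (wt 0 - (scoroot 0 : V n) 0 • lroot 0 : Module.Dual ℚ (V n)) = -wt 0 := by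
      rw [scoroot_zero, lroot_zero, theta, Pi.neg_apply, eps_apply, if_pos rfl]
      module
    rw [coeffRefl_om_zero, h, formToS_neg_wt, om_zero, Om_mul_neg]
  · rw [om_of_ne_zero hi, coeffRefl, mapCoeff_one, one_mul]

/-- Both α_i and f - s_i f change sign under s_i, so their quotient is fixed. With `divDiff_eq_zero`
this gives A_i² = 0. -/
theorem reflAct_divDiff (i : Fin (n + 1)) (f : hatLam n) :
    reflAct i (divDiff i f) = divDiff i f := by
  apply smul_hatLam_cancel (rootS_ne_zero i)
  have h := congrArg (reflAct i) (divDiff_spec i f)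
  rw [reflAct_smul, reflAct_sub, reflAct_reflAct, linAct_lrefl_rootS, lroot_scoroot_self] at h
  have h2 : (rootS i - MvPolynomial.C (((2 : ℚ) : ℂ)) * rootS i : S n) = -rootS i := by
    rw [Rat.cast_ofNat, map_ofNat]; ring
  rw [h2, neg_smul] at h
  rw [divDiff_spec, ← neg_inj, h]
  abel

theorem divDiff_eq_zero {i : Fin (n + 1)} {f : hatLam n} (h : reflAct i f = f) :
    divDiff i f = 0 := by
  apply smul_hatLam_cancel (rootS_ne_zero i)
  rw [divDiff_spec, h, sub_self, smul_zero]

theorem reflAct_eq_self {i : Fin (n + 1)} {f : hatLam n} (h : divDiff i f = 0) :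
    reflAct i f = f := by
  have := divDiff_spec i f
  rw [h, smul_zero] at this
  exact (sub_eq_zero.1 this.symm).symm

theorem linAct_lrefl_rootS_cartan {i j : Fin (n + 1)} {c : ℤ}
    (h : lroot j (scoroot i : V n) = c) :
    (linAct (lrefl i) (rootS j) : S n) = rootS j - c * rootS i := by
  rw [linAct_lrefl_rootS, h]
  simp

theorem linAct_rootS_ne_zero (g : V n ≃ₗ[ℚ] V n) (j : Fin (n + 1)) :
    linAct g (rootS j) ≠ 0 := by
  rw [rootS_eq, linAct_formToS]
  refine formToS_ne_zero fun h => ?_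
  have h1 := LinearMap.congr_fun h (g (scoroot j))
  have h2 := lroot_scoroot_self (n := n) j
  simp [h2] at h1

theorem linAct_lrefl_rootS_self (i : Fin (n + 1)) :
    (linAct (lrefl i) (rootS i) : S n) = -rootS i := by
  rw [linAct_lrefl_rootS_cartan (c := 2) (by rw [lroot_scoroot_self]; norm_num)]
  push_cast; ring

/-- Multiplying by the positive roots of the rank two subsystem, which can be cancelled, turns both
sides into signed sums that agree by `braidRels_reflAct`. -/
theorem braidRels_divDiff : BraidRels (divDiff : Fin (n + 1) → hatLam n → hatLam n) where
  two {i j} h h' f := by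
    have hi : (linAct (lrefl i) (rootS j) : S n) = rootS j := by
      rw [linAct_lrefl_rootS, h]; simp
    have hj : (linAct (lrefl j) (rootS i) : S n) = rootS i := by
      rw [linAct_lrefl_rootS, h']; simp
    apply smul_hatLam_cancel (mul_ne_zero (rootS_ne_zero i) (rootS_ne_zero j))
    rw [divDiff_formula_two (divDiff_spec i) (divDiff_spec j) (reflAct_sub i) (reflAct_smul i) hi,
      mul_comm, divDiff_formula_two (divDiff_spec j) (divDiff_spec i) (reflAct_sub j)
        (reflAct_smul j) hj, braidRels_reflAct.two h h']
    abel
  three {i j} h h' f := by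
    have hi : (linAct (lrefl i) (rootS j) : S n) = rootS i + rootS j := by
      rw [linAct_lrefl_rootS_cartan (c := -1) (by rw [h]; norm_num)]; push_cast; ring
    have hj : (linAct (lrefl j) (rootS i) : S n) = rootS i + rootS j := by
      rw [linAct_lrefl_rootS_cartan (c := -1) (by rw [h']; norm_num)]; push_cast; ring
    have hii := linAct_lrefl_rootS_self (n := n) i
    have hjj := linAct_lrefl_rootS_self (n := n) j
    have hne : (rootS i + rootS j : S n) ≠ 0 := hi ▸ linAct_rootS_ne_zero _ _
    apply smul_hatLam_cancel (mul_ne_zero (mul_ne_zero (rootS_ne_zero i) (rootS_ne_zero j)) hne)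
    rw [divDiff_formula_three (divDiff_spec i) (divDiff_spec j) (reflAct_divDiff i)
        (reflAct_sub i) (reflAct_smul i) (reflAct_sub j) (reflAct_smul j) rfl hi hj
        (by rw [map_add, hi, hii]; ring),
      mul_comm (rootS i : S n) (rootS j), divDiff_formula_three (divDiff_spec j) (divDiff_spec i)
        (reflAct_divDiff j) (reflAct_sub j) (reflAct_smul j) (reflAct_sub i) (reflAct_smul i)
        (add_comm _ _) hj hi (by rw [map_add, hj, hjj]; ring), braidRels_reflAct.three h h']
    abel
  four {i j} h h' f := by
    have hii := linAct_lrefl_rootS_self (n := n) i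
    have hjj := linAct_lrefl_rootS_self (n := n) j
    have hi : (linAct (lrefl i) (rootS j) : S n) = rootS j + 1 * rootS i := by
      rw [linAct_lrefl_rootS_cartan (c := -1) (by rw [h]; norm_num)]; push_cast; ring
    have hj : (linAct (lrefl j) (rootS i) : S n) = rootS i + 2 * rootS j := by
      rw [linAct_lrefl_rootS_cartan (c := -2) (by rw [h']; norm_num)]; push_cast; ring
    have h2 : ∀ k : Fin (n + 1), (linAct (lrefl k) 2 : S n) = 2 := fun k => map_ofNat _ 2
    have hγ : (rootS j + 1 * rootS i : S n) ≠ 0 := hi ▸ linAct_rootS_ne_zero _ _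
    have hδ : (rootS i + 2 * rootS j : S n) ≠ 0 := hj ▸ linAct_rootS_ne_zero _ _
    have hiγ : (linAct (lrefl i) (rootS j + 1 * rootS i) : S n) = rootS j := by
      rw [map_add, map_mul, map_one, hi, hii]; ring
    have hiδ : (linAct (lrefl i) (rootS i + 2 * rootS j) : S n) = rootS i + 2 * rootS j := by
      rw [map_add, map_mul, h2, hi, hii]; ring
    have hjγ : (linAct (lrefl j) (rootS j + 1 * rootS i) : S n) = rootS j + 1 * rootS i := by
      rw [map_add, map_mul, map_one, hj, hjj]; ring
    have hjδ : (linAct (lrefl j) (rootS i + 2 * rootS j) : S n) = rootS i := by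
      rw [map_add, map_mul, h2, hj, hjj]; ring
    have e1 := smul_hatLam_cancel (rootS_ne_zero j) (divDiff_formula_four (divDiff_spec i)
      (divDiff_spec j) (reflAct_divDiff i) (reflAct_divDiff j) (reflAct_sub i) (reflAct_smul i)
      (reflAct_sub j) (reflAct_smul j) (one_mul 2) rfl rfl hi hj hiδ hjγ hjδ f)
    have e2 := smul_hatLam_cancel (rootS_ne_zero i) (divDiff_formula_four (divDiff_spec j)
      (divDiff_spec i) (reflAct_divDiff j) (reflAct_divDiff i) (reflAct_sub j) (reflAct_smul j)
      (reflAct_sub i) (reflAct_smul i) (mul_one 2) rfl rfl hj hi hjγ hiδ hiγ f)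
    apply smul_hatLam_cancel (mul_ne_zero (mul_ne_zero (mul_ne_zero (rootS_ne_zero i)
      (rootS_ne_zero j)) hγ) hδ)
    rw [e1, show (rootS i * rootS j * (rootS j + 1 * rootS i) * (rootS i + 2 * rootS j) : S n) =
      rootS j * rootS i * (rootS i + 2 * rootS j) * (rootS j + 1 * rootS i) by ring, e2,
      braidRels_reflAct.four h h']
    abel

end

/-! ## Factorization -/

section
variable {n : ℕ} [NeZero n]

/-- This removes the chosen reduced word from the definition; every later computation selects a word
suited to it. -/
theorem Phat_eq_foldr {ω : List (Fin (n + 1))} (h : IsReducedWord ω) :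
    Phat (wordProd ω : Aff n) = ω.foldr divDiff (1 : hatLam n) := by
  have hmem := wordProd_mem (n := n) ω
  have hr : (wordProd (redWord (wordProd ω : Aff n)) : Aff n) = wordProd ω ∧
      (redWord (wordProd ω : Aff n)).length = len (wordProd ω : Aff n) := by
    rw [redWord, dif_pos hmem]
    exact (exists_reduced hmem).choose_spec
  exact braidRels_divDiff.foldr_eq _ _ _ rfl (by rw [IsReducedWord, hr.2, hr.1]) h hr.1 1

theorem divDiff_one_of_ne_zero {i : Fin (n + 1)} (h : i ≠ 0) : divDiff i (1 : hatLam n) = 0 :=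
  divDiff_eq_zero (by rw [reflAct_eq, om_of_ne_zero h, coeffRefl, mapCoeff_one, one_mul])

theorem divDiff_zero (i : Fin (n + 1)) : divDiff i (0 : hatLam n) = 0 :=
  divDiff_eq_zero (by
    have h := reflAct_sub (n := n) i 0 0
    rwa [sub_self, sub_self] at h)

theorem simpleRefl_mul_transl {j : Fin (n + 1)} {μ : V n} (h : lroot j μ = 0) :
    simpleRefl j * transl μ = transl μ * simpleRefl j := by
  ext1 x
  rw [mul_apply_aff, mul_apply_aff, transl_apply, transl_apply, simpleRefl_apply,
    simpleRefl_apply, add_comm μ x, sroot_add, h, add_zero]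
  abel

/-- The reflection in the root `2 a_k`. -/
def flip {n : ℕ} (k : Fin n) : V n ≃ₗ[ℚ] V n :=
  Module.reflection (show ((2 : ℚ) • wt k : Module.Dual ℚ (V n)) (eps k) = 2 by simp [wt, eps])

theorem flip_apply {n : ℕ} (k : Fin n) (x : V n) : flip k x = x - (2 * x k) • eps k :=
  Module.reflection_apply _ _

theorem lrefl_zero_eq_flip : (lrefl 0 : V n ≃ₗ[ℚ] V n) = flip 0 := lrefl_zero

theorem lrefl_last_eq_flip {k : Fin n} (h : ¬ (k : ℕ) + 1 < n) : lrefl k.succ = flip k := by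
  ext1 x
  rw [lrefl_apply, flip_apply, lroot_succ, scoroot_succ, simpleRoot, simpleCoroot, dif_neg h,
    dif_neg h]
  rfl

theorem lrefl_mid_apply {k : Fin n} (h : (k : ℕ) + 1 < n) (x : V n) :
    lrefl k.succ x = x - (x k - x ⟨k + 1, h⟩) • (eps k - eps ⟨k + 1, h⟩) := by
  rw [lrefl_apply, lroot_succ, scoroot_succ, simpleRoot, simpleCoroot, dif_pos h, dif_pos h]
  rfl

theorem lrefl_flip_lrefl {k : Fin n} (h : (k : ℕ) + 1 < n) (x : V n) :
    lrefl k.succ (flip k (lrefl k.succ x)) = flip ⟨k + 1, h⟩ x := by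
  rw [lrefl_mid_apply h x, flip_apply, lrefl_mid_apply h, flip_apply]
  have hne : k ≠ ⟨k + 1, h⟩ := by simp [Fin.ext_iff]
  simp only [Pi.sub_apply, Pi.smul_apply, eps_apply, smul_eq_mul, if_pos, if_neg hne,
    if_neg hne.symm]
  module

theorem coeffRefl_flip {k : Fin n} (h : (k : ℕ) + 1 < n) {f : hatLam n}
    (hf : coeffRefl k.succ f = f) :
    coeffRefl k.succ (mapCoeff (linAct (flip k)) f) =
      mapCoeff (linAct (flip ⟨k + 1, h⟩)) f := by
  conv_lhs => rw [← hf]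
  simp only [coeffRefl, mapCoeff_linAct]
  congr 2
  ext1 x
  exact lrefl_flip_lrefl h x

theorem coeffRefl_Om_X {k : Fin n} (h : (k : ℕ) + 1 < n) :
    coeffRefl k.succ (Om (MvPolynomial.X k) : hatLam n) = Om (MvPolynomial.X ⟨k + 1, h⟩) := by
  have hne : k ≠ ⟨k + 1, h⟩ := by simp [Fin.ext_iff]
  have h1 : wt k (scoroot k.succ : V n) = 1 := by
    rw [scoroot_succ, simpleCoroot, dif_pos h]
    change (eps k - eps ⟨k + 1, h⟩ : V n) k = 1
    rw [Pi.sub_apply, eps_apply, eps_apply, if_pos rfl, if_neg hne, sub_zero]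
  rw [← formToS_wt, coeffRefl_Om, h1, lroot_succ, simpleRoot, dif_pos h, ← formToS_wt]
  congr 2
  module

theorem coeffRefl_pow (i : Fin (n + 1)) (g : hatLam n) (e : ℕ) :
    coeffRefl i (g ^ e) = coeffRefl i g ^ e := by
  induction e with
  | zero => rw [pow_zero, pow_zero]; exact mapCoeff_one _
  | succ e ih => rw [pow_succ, pow_succ, coeffRefl_mul, ih]

/-- Whether `f` is semi-invariant under the sign change of `a_k` does not depend on `k` if `f` is
invariant under the permutations of the `a_k`. -/
theorem flip_semiInvariant_iff (e : ℕ) {f : hatLam n}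
    (hf : ∀ k : Fin n, (k : ℕ) + 1 < n → coeffRefl k.succ f = f) (k : Fin n) :
    f = Om (MvPolynomial.X 0) ^ e * mapCoeff (linAct (flip 0)) f ↔
      f = Om (MvPolynomial.X k) ^ e * mapCoeff (linAct (flip k)) f := by
  obtain ⟨k, hk⟩ := k
  induction k with
  | zero => rfl
  | succ k ih =>
    rw [ih (by omega)]
    have hfk := hf ⟨k, by omega⟩ hk
    -- The transposition s_k turns the relation for a_k into the one for a_{k+1}, and being an
    -- involution it also leads back.
    have key : coeffRefl (⟨k, by omega⟩ : Fin n).succ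
        (Om (MvPolynomial.X ⟨k, by omega⟩) ^ e * mapCoeff (linAct (flip ⟨k, by omega⟩)) f) =
        Om (MvPolynomial.X ⟨k + 1, hk⟩) ^ e * mapCoeff (linAct (flip ⟨k + 1, hk⟩)) f := by
      rw [coeffRefl_mul, coeffRefl_pow, coeffRefl_Om_X hk, coeffRefl_flip hk hfk]
    constructor
    · intro h
      rw [← key, ← h, hfk]
    · intro h
      rw [← key] at h
      have := congrArg (coeffRefl (⟨k, by omega⟩ : Fin n).succ) h
      rwa [hfk, coeffRefl_coeffRefl] at this

/-! ### Annihilation of `Phat` at κ and twisted multiplicativity -/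

namespace DiagramAut
variable (D : DiagramAut n)

/-- Let k be the finite node to which j is sent. For k = i the letter j is a left descent of κ and
A_j² = 0 applies. For k ≠ i the reflection passes through κ to the right, where it meets the
constant 1. -/
theorem divDiff_Phat_eq_zero {i : Fin n} (hκ : D.toAff * transl (-fundCoweight i) ∈ Waf n)
    {j : Fin (n + 1)} (hj : D.node j ≠ 0) :
    divDiff j (Phat (D.toAff * transl (-fundCoweight i))) = 0 := by
  obtain ⟨k, hk⟩ := Fin.exists_succ_eq.2 hj
  have hn := natCast_pos' (n := n)
  -- Every simple root is 1/(2n) at the base point, and the translation lowers only the one at the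
  -- node i, by 1. The sign thus detects whether k = i.
  have hval : sroot j ((D.toAff * transl (-fundCoweight i)) (basePt n)) =
      1 / (2 * n) - if k = i then 1 else 0 := by
    rw [mul_apply_aff, D.sroot_apply, ← hk, transl_apply, add_comm, sroot_add, sroot_basePt,
      map_neg, lroot_fundCoweight]
    ring
  by_cases hki : k = i
  · have hneg : sroot j ((D.toAff * transl (-fundCoweight i)) (basePt n)) < 0 := by
      rw [hval, if_pos hki, sub_neg, div_lt_one (by positivity)]
      have : (1 : ℚ) ≤ n := by exact_mod_cast NeZero.one_le
      linarith
    obtain ⟨ω, h1, h2⟩ := exists_reduced_descents hκ [j] (by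
      rintro (_ | ⟨a, σ⟩) b σ' hσ
      · rw [List.nil_append, List.cons.injEq] at hσ
        obtain ⟨rfl, -⟩ := hσ
        rw [List.reverse_nil, show (wordProd [] : Aff n) = 1 from rfl, one_mul]
        exact hneg
      · simp at hσ)
    rw [← h2, Phat_eq_foldr h1]
    exact divDiff_eq_zero (reflAct_divDiff j _)
  · obtain ⟨ω, h1, h2⟩ := exists_reduced_descents hκ [] (by simp)
    rw [List.nil_append] at h1 h2
    have hpos : 0 < sroot j ((wordProd ω : Aff n) (basePt n)) := by
      rw [h2, hval, if_neg hki, sub_zero]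
      positivity
    have h3 := h1.cons hpos
    -- Prepending j and appending its image spell the same element. The words have equal length, so
    -- both are reduced and define the same operator.
    have h4 : (wordProd (j :: ω) : Aff n) = wordProd (ω ++ [D.node j]) := by
      rw [wordProd_cons, wordProd_append, h2, ← mul_assoc, D.simpleRefl_mul, mul_assoc,
        simpleRefl_mul_transl, mul_assoc]
      · simp [wordProd]
      · rw [← hk, map_neg, lroot_fundCoweight, if_neg hki, neg_zero]
    have h5 : IsReducedWord (ω ++ [D.node j]) := by
      rw [IsReducedWord, ← h4, ← h3]
      simp
    rw [← h2, Phat_eq_foldr h1, ← List.foldr_cons (f := divDiff),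
      braidRels_divDiff.foldr_eq _ _ _ rfl h3 h5 h4, List.foldr_append, List.foldr_cons,
      List.foldr_nil, divDiff_one_of_ne_zero hj]
    clear h1 h2 h3 h4 h5 hpos
    induction ω with
    | nil => rfl
    | cons a ω ih => rw [List.foldr_cons, ih, divDiff_zero]

/-- The action of the linear part on the coefficients. -/
def act (f : hatLam n) : hatLam n := mapCoeff (linAct D.lin) f

/-- `F` intertwines the action of `s_j` with that of its image under the automorphism. -/
def IsTwist (F : hatLam n) : Prop :=
  ∀ j, om j * coeffRefl j F = F * D.act (om (D.node j))

theorem act_coeffRefl (j : Fin (n + 1)) (f : hatLam n) :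
    D.act (coeffRefl (D.node j) f) = coeffRefl j (D.act f) := by
  simp only [act, coeffRefl, mapCoeff_linAct]
  congr 2
  ext1 x
  change D.lin (lrefl (D.node j) x) = lrefl j (D.lin x)
  rw [lrefl_apply, lrefl_apply, map_sub, map_smul, D.lin_scoroot, D.lroot_lin]

theorem linAct_rootS (j : Fin (n + 1)) : linAct D.lin (rootS (D.node j)) = rootS j := by
  rw [rootS_eq, rootS_eq, linAct_formToS]
  congr 1
  refine LinearMap.ext fun x => ?_
  rw [LinearMap.comp_apply, ← D.lroot_lin]
  exact congrArg _ (D.lin.apply_symm_apply x)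

/-- The twist condition makes g ↦ F · act g intertwine the reflections, and the linear part takes
the root at the image node to α_j. Dividing by that root gives the same intertwining for divided
differences. -/
theorem divDiff_mul_act {F : hatLam n} (hF : D.IsTwist F) (j : Fin (n + 1)) (g : hatLam n) :
    divDiff j (F * D.act g) = F * D.act (divDiff (D.node j) g) := by
  apply smul_hatLam_cancel (rootS_ne_zero j)
  rw [divDiff_spec, ← mul_smul_comm, ← D.linAct_rootS j]
  have h1 : linAct D.lin (rootS (D.node j)) • D.act (divDiff (D.node j) g) =
      D.act g - D.act (om (D.node j)) * coeffRefl j (D.act g) := by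
    rw [← D.act_coeffRefl, act, act, act, act, ← mapCoeff_smul, divDiff_spec, mapCoeff_sub,
      reflAct_eq, mapCoeff_mul]
  rw [h1, reflAct_eq, coeffRefl_mul, ← mul_assoc, hF j]
  ring

theorem foldr_mul_act {F : hatLam n} (hF : D.IsTwist F) (ω : List (Fin (n + 1)))
    (g : hatLam n) :
    ω.foldr divDiff (F * D.act g) = F * D.act ((ω.map D.node).foldr divDiff g) := by
  induction ω with
  | nil => rfl
  | cons j ω ih => rw [List.map_cons, List.foldr_cons, List.foldr_cons, ih, D.divDiff_mul_act hF]

theorem Phat_mul {v κ : Aff n} (hv : v ∈ Waf n) (hκ : κ ∈ Waf n)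
    (hlen : len (v * κ) = len v + len κ) (hF : D.IsTwist (Phat κ)) :
    Phat (v * κ) = Phat κ * D.act (Phat (D.toAff⁻¹ * v * D.toAff)) := by
  obtain ⟨ω, rfl, h1⟩ := exists_reduced hv
  obtain ⟨ω', rfl, h2⟩ := exists_reduced hκ
  have h3 : IsReducedWord (ω ++ ω') := by
    rw [IsReducedWord, wordProd_append, hlen, ← h1, ← h2, List.length_append]
  have h4 : IsReducedWord (ω.map D.node) := by
    rw [IsReducedWord, ← D.conj_wordProd, D.len_conj hv, ← h1, List.length_map]
  have h5 := D.foldr_mul_act hF ω 1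
  rw [show D.act 1 = 1 from mapCoeff_one _, mul_one] at h5
  rw [D.conj_wordProd, Phat_eq_foldr h4, ← h5, ← wordProd_append, Phat_eq_foldr h3,
    Phat_eq_foldr h2, List.foldr_append]

theorem reflAct_Phat {i : Fin n} (hκ : D.toAff * transl (-fundCoweight i) ∈ Waf n)
    {j : Fin (n + 1)} (hj : D.node j ≠ 0) :
    om j * coeffRefl j (Phat (D.toAff * transl (-fundCoweight i))) =
      Phat (D.toAff * transl (-fundCoweight i)) := by
  rw [← reflAct_eq]
  exact reflAct_eq_self (D.divDiff_Phat_eq_zero hκ hj)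

end DiagramAut

theorem act_trivial (f : hatLam n) : (DiagramAut.trivial n).act f = f := by
  -- The identity map is obtained as the square of a reflection, whose action on coefficients is
  -- known to be an involution.
  have h := coeffRefl_coeffRefl 0 f
  simp only [coeffRefl, mapCoeff_linAct] at h
  have h2 : (lrefl 0 : V n ≃ₗ[ℚ] V n).trans (lrefl 0) = LinearEquiv.refl ℚ _ := by
    ext1 x
    exact Module.involutive_reflection (lroot_scoroot_self 0) x
  rwa [h2] at h

/-- All finite reflections fix F, so only the node 0 needs an argument: s_θ, the sign change of a_1,
is conjugate to s_n, the sign change of a_n, through permutations that fix F. -/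
theorem isTwist_trivial {i : Fin n}
    (hκ : (DiagramAut.trivial n).toAff * transl (-fundCoweight i) ∈ Waf n) :
    (DiagramAut.trivial n).IsTwist
      (Phat ((DiagramAut.trivial n).toAff * transl (-fundCoweight i))) := by
  have hn := NeZero.pos n
  have hinv : ∀ k : Fin n, coeffRefl k.succ
      (Phat ((DiagramAut.trivial n).toAff * transl (-fundCoweight i))) =
        Phat ((DiagramAut.trivial n).toAff * transl (-fundCoweight i)) := by
    intro k
    have h := (DiagramAut.trivial n).reflAct_Phat hκ (j := k.succ) (Fin.succ_ne_zero k)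
    rwa [om_of_ne_zero (Fin.succ_ne_zero k), one_mul] at h
  intro j
  rw [act_trivial, mul_comm]
  congr 1
  refine Fin.cases ?_ (fun k => hinv k) j
  -- Exponent 0 expresses plain invariance, here transported from a_n back to a_1.
  have h := (flip_semiInvariant_iff 0 (fun k _ => hinv k) (⟨n - 1, by omega⟩ : Fin n)).2 (by
    have h1 := hinv ⟨n - 1, by omega⟩
    rw [coeffRefl, lrefl_last_eq_flip (by dsimp only; omega)] at h1
    rw [pow_zero, one_mul, h1])
  rw [pow_zero, one_mul] at h
  rw [coeffRefl, lrefl_zero_eq_flip]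
  exact h.symm

/-- Every s_j with j ≠ n fixes F, and its image node is not 0, so no factor Ω appears. At j = n the
factor is u_n(Ω(a_1)) = Ω(-a_n), and it is matched by the semi-invariance of F under s_0 carried
from a_1 to a_n. -/
theorem isTwist_ofPiN {i : Fin n}
    (hκ : (DiagramAut.ofPiN n).toAff * transl (-fundCoweight i) ∈ Waf n) :
    (DiagramAut.ofPiN n).IsTwist
      (Phat ((DiagramAut.ofPiN n).toAff * transl (-fundCoweight i))) := by
  have hn := NeZero.pos n
  set F := Phat ((DiagramAut.ofPiN n).toAff * transl (-fundCoweight i))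
  have hnode : ∀ j : Fin (n + 1), ((DiagramAut.ofPiN n).node j = 0) ↔ (j : ℕ) = n := by
    intro j
    change Fin.rev j = 0 ↔ _
    rw [Fin.ext_iff, Fin.val_rev, Fin.val_zero]
    omega
  have hfix : ∀ j : Fin (n + 1), (j : ℕ) ≠ n → om j * coeffRefl j F = F := fun j hj =>
    (DiagramAut.ofPiN n).reflAct_Phat hκ (fun h => hj ((hnode j).1 h))
  intro j
  by_cases hj : (j : ℕ) = n
  · obtain ⟨k, rfl⟩ := Fin.exists_succ_eq.2 (show j ≠ 0 by
      rintro rfl; rw [Fin.val_zero] at hj; omega)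
    rw [Fin.val_succ] at hj
    rw [(hnode k.succ).2 (by rw [Fin.val_succ, hj])]
    have h0 := hfix 0 (by rw [Fin.val_zero]; omega)
    -- Exponent 1 records the factor Ω(a_1) in the equation s_0 F = F; the reflections s_1, …,
    -- s_{n-1} carry it to a_n.
    have h := (flip_semiInvariant_iff 1 (f := F) (fun k' hk => by
      have h := hfix k'.succ (by rw [Fin.val_succ]; omega)
      rwa [om_of_ne_zero (Fin.succ_ne_zero k'), one_mul] at h) k).1 (by
      rw [coeffRefl, lrefl_zero_eq_flip, om_zero] at h0
      rw [pow_one, h0])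
    have hact : (DiagramAut.ofPiN n).act (om 0) = Om (-MvPolynomial.X k) := by
      rw [DiagramAut.act, om_zero, mapCoeff_Om, linAct_X, ← formToS_neg_wt]
      congr 2
      refine LinearMap.ext fun x => ?_
      have : (DiagramAut.ofPiN n).lin.symm x = uN n x := by
        rw [LinearEquiv.symm_apply_eq]
        funext p
        change x p = uN n (uN n x) p
        rw [uN_apply, uN_apply, Fin.rev_rev, neg_neg]
      change (DiagramAut.ofPiN n).lin.symm x 0 = -x k
      rw [this, uN_apply]
      congr 2
      apply Fin.ext
      rw [Fin.val_rev, Fin.val_zero]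
      omega
    rw [hact, om_of_ne_zero (Fin.succ_ne_zero _), one_mul, coeffRefl,
      lrefl_last_eq_flip (by omega)]
    rw [pow_one] at h
    conv_rhs => rw [h]
    rw [mul_comm (Om _), mul_assoc, Om_mul_neg, mul_one]
  · rw [hfix j hj, om_of_ne_zero (fun h => hj ((hnode j).1 h)), DiagramAut.act, mapCoeff_one,
      mul_one]

end

end AffC

end

/-! ### The factorization theorem -/

theorem mainTheorem8 (n : ℕ) [NeZero n] (i : Fin n) (v : AffC.Aff n)
    (hv : v ∈ AffC.Waf n)
    (hvκ : v * AffC.kappa i ∈ AffC.Waf0 n)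
    (hlen : AffC.len (v * AffC.kappa i) = AffC.len v + AffC.len (AffC.kappa i)) :
    ((i : ℕ) + 1 < n →
      v ∈ AffC.Waf0 n ∧
      AffC.Phat (v * AffC.kappa i) = AffC.Phat (AffC.kappa i) * AffC.Phat v) ∧
    ((i : ℕ) + 1 = n →
      (AffC.piN n)⁻¹ * v * AffC.piN n ∈ AffC.Waf0 n ∧
      AffC.Phat (v * AffC.kappa i) =
        AffC.Phat (AffC.kappa i) *
          AffC.substUN (AffC.Phat ((AffC.piN n)⁻¹ * v * AffC.piN n))) := by
  -- Membership of κ_i in W_af follows from that of v and vκ_i, so no explicit word for κ_i is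
  -- needed.
  have hκ : AffC.kappa i ∈ AffC.Waf n := ((AffC.Waf n).mul_mem_cancel_left hv).1 hvκ.1
  have hμ := (AffC.isCoweight_fundCoweight i).neg
  constructor
  · intro hi
    have hk : AffC.kappa i = (AffC.DiagramAut.trivial n).toAff *
        AffC.transl (-AffC.fundCoweight i) := by rw [AffC.kappa, if_pos hi]; rfl
    have hbar : (AffC.DiagramAut.trivial n).toAff⁻¹ * v *
        (AffC.DiagramAut.trivial n).toAff = v := by
      change 1⁻¹ * v * 1 = v
      rw [inv_one, one_mul, mul_one]
    rw [hk] at hκ hvκ hlen ⊢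
    have h1 := (AffC.DiagramAut.trivial n).conj_mem_Waf0 hv hμ hvκ hlen
    have h2 := (AffC.DiagramAut.trivial n).Phat_mul hv hκ hlen (AffC.isTwist_trivial hκ)
    rw [hbar] at h1 h2
    rw [AffC.act_trivial] at h2
    exact ⟨h1, h2⟩
  · intro hi
    have hk : AffC.kappa i = (AffC.DiagramAut.ofPiN n).toAff *
        AffC.transl (-AffC.fundCoweight i) := by rw [AffC.kappa, if_neg (by omega)]; rfl
    rw [hk] at hκ hvκ hlen ⊢
    exact ⟨(AffC.DiagramAut.ofPiN n).conj_mem_Waf0 hv hμ hvκ hlen,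
      (AffC.DiagramAut.ofPiN n).Phat_mul hv hκ hlen (AffC.isTwist_ofPiN hκ)⟩
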